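/- **Setting.** Let $N\ge 2$ arms $1,\dots,N$ be given. When the user is shown arms $i$ and $j$, she prefers $i$ with probability $p_{i,j}\in[0,1]$, independently of the past given the pair shown, where $p_{i,j}=1-p_{j,i}$. Assume a total order: $p_{i,j}>\tfrac12$ for all $i<j$, so arm $1$ is the best arm. Put $p=\min\{p_{i,j}:p_{i,j}>\tfrac12\}$. The strong regret of a time period is $0$ if the best arm is pulled twice in it and $1$ otherwise, and $R(T)$ is the sum of the regrets of the periods $1,\dots,T$. **WS-W.** Let $C(i)$ be the number of duels won minus the number of duels lost so far by arm $i$. The next duel is between an arm $i_t\in\arg\max_i C(i)$ and an arm $j_t\in\arg\max_{j\ne i_t}C(j)$. In each of the two choices, ties are broken in favour of the first arm of the previous duel, then in favour of the second arm of the previous duel, and otherwise uniformly at random. Round $\ell\ge 1$ ends as soon as some arm $Z(\ell)$, the winner of the round, has $C(Z(\ell))=(N-1)\ell$ while $C(i)=-\ell$ for all other arms $i$. **WS-S.** With a parameter $\beta>1$, for $\ell=1,2,\dots$: run the $\ell$-th round of WS-W (which continues from its own state at the end of round $\ell-1$), then pull the pair $(Z(\ell),Z(\ell))$ during the next $\lfloor\beta^{\ell}\rfloor$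 periods and ignore the feedback. **Theorem.** Let $1<\beta<\frac{p}{1-p}$ (only $1<\beta$ if $p=1$). Then the expected cumulative strong regret of WS-S satisfies, for every $T\ge 0$, $$\mathbb E[R(T)]\le \frac{2p^3}{(2p-1)^6}N(\log N+1)+\frac{N\log_\beta\bigl(T(\beta-1)+1\bigr)}{2p-1},$$ and, for every $T\ge \frac{1}{(\beta-1)^2}$, $$\mathbb E[R(T)]\le \frac{2p^3}{(2p-1)^6}N(\log N+1)+\frac{N\log_\beta\bigl(T(\beta-1)\bigr)}{2p-1}.$$ Consequently it is $O(N\log N+N\log T)$: there is a constant $K$ depending only on $p$ and $\beta$ such that $\mathbb E[R(T)]\le K(N\log N+N\log T)$ for all $N\ge2$, all such $(p_{i,j})$ and all $T\ge 1$. -/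

import Mathlib

open scoped ENNReal

noncomputable section

namespace DuelingBandit

/-- Preference probabilities for `N` arms: `prob i j` is the probability that the user prefers
arm `i` when shown the arms `i` and `j`. -/
structure Preference (N : ℕ) where
  prob : Fin N → Fin N → ℝ
  nonneg : ∀ i j, 0 ≤ prob i j
  symm : ∀ i j, prob i j = 1 - prob j i

/-- The arms are totally ordered: they are labelled from best to worst, and the better arm of any
two arms is preferred with probability greater than `1/2`. In particular arm `0` is the best. -/
def Preference.TotallyOrdered {N : ℕ} (P : Preference N) : Prop :=
  ∀ i j : Fin N, i < j → 1 / 2 < P.prob i j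

/-- The probabilities of preference exceeding `1/2`. The least of them is the constant `p`. -/
def Preference.favourProbs {N : ℕ} (P : Preference N) : Set ℝ :=
  {x | ∃ i j : Fin N, x = P.prob i j ∧ 1 / 2 < x}

/-- The random feedback of a duel between `i` and `j`; `true` means that `i` wins. -/
def Preference.feedback {N : ℕ} (P : Preference N) (i j : Fin N) : PMF Bool :=
  PMF.ofFintype (fun b => ENNReal.ofReal (if b then P.prob i j else P.prob j i)) (by
    rw [Fintype.sum_bool, if_pos rfl, if_neg Bool.false_ne_true,
      ← ENNReal.ofReal_add (P.nonneg i j) (P.nonneg j i), P.symm i j]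
    simp)

/-- A duel that has taken place: the two arms shown, in their order, and whether the first won. -/
structure Duel (N : ℕ) where
  fst : Fin N
  snd : Fin N
  fstWins : Bool

/-- In the duel `d`, arm `i` defeats arm `j`. -/
def Duel.Defeats {N : ℕ} (d : Duel N) (i j : Fin N) : Prop :=
  (d.fst = i ∧ d.snd = j ∧ d.fstWins = true) ∨ (d.fst = j ∧ d.snd = i ∧ d.fstWins = false)

open Classical in
/-- The number of duels in the history `h` in which arm `i` defeated arm `j`. -/
def wins {N : ℕ} (h : List (Duel N)) (i j : Fin N) : ℕ :=
  h.countP (fun d => decide (d.Defeats i j))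

/-- The score `C(i)`: the number of duels won minus the number of duels lost by arm `i`. -/
def score {N : ℕ} (h : List (Duel N)) (i : Fin N) : ℤ :=
  ∑ j ∈ Finset.univ.erase i, ((wins h i j : ℤ) - (wins h j i : ℤ))

/-- The arms of `s` at which `C` is maximal over `s`. -/
def argmax {N : ℕ} (s : Finset (Fin N)) (C : Fin N → ℤ) : Finset (Fin N) :=
  s.filter (fun i => ∀ k ∈ s, C k ≤ C i)

theorem argmax_nonempty {N : ℕ} {s : Finset (Fin N)} (hs : s.Nonempty) (C : Fin N → ℤ) :
    (argmax s C).Nonempty := by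
  obtain ⟨i, hi, h⟩ := s.exists_max_image C hs
  exact ⟨i, Finset.mem_filter.2 ⟨hi, h⟩⟩

/-- Choice of an arm from a nonempty set `A` of tied arms: the first arm of the last duel if it is
in `A`, else the second arm of the last duel if it is in `A`, else a uniformly random arm. -/
def breakTie {N : ℕ} (A : Finset (Fin N)) (hA : A.Nonempty) : Option (Duel N) → PMF (Fin N)
  | none => PMF.uniformOfFinset A hA
  | some d =>
    if d.fst ∈ A then PMF.pure d.fst
    else if d.snd ∈ A then PMF.pure d.snd
    else PMF.uniformOfFinset A hA

theorem univ_nonempty (N : ℕ) [N.AtLeastTwo] : (Finset.univ : Finset (Fin N)).Nonempty :=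
  Finset.card_pos.1 (by
    have := Nat.AtLeastTwo.prop (n := N)
    rw [Finset.card_univ, Fintype.card_fin]; omega)

theorem erase_nonempty {N : ℕ} [N.AtLeastTwo] (i : Fin N) : (Finset.univ.erase i).Nonempty :=
  Finset.card_pos.1 (by
    have := Nat.AtLeastTwo.prop (n := N)
    rw [Finset.card_erase_of_mem (Finset.mem_univ i), Finset.card_univ, Fintype.card_fin]; omega)

/-- The pair of arms `(i_t, j_t)` shown next by WS-W (Winner Stays for weak regret) after the
history `h` of duels, the most recent duel standing first. -/
def wswPair {N : ℕ} [N.AtLeastTwo] (h : List (Duel N)) : PMF (Fin N × Fin N) :=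
  (breakTie (argmax Finset.univ (score h))
      (argmax_nonempty (univ_nonempty N) _) h.head?).bind fun i =>
    (breakTie (argmax (Finset.univ.erase i) (score h))
      (argmax_nonempty (erase_nonempty i) _) h.head?).map fun j => (i, j)

/-- With the history `h`, the score of arm `Z` is `(N - 1) ℓ` and that of every other arm is `-ℓ`.
The `ℓ`-th round of WS-W ends as soon as this happens, for some arm `Z`, the winner of the round. -/
def WinsRound {N : ℕ} (h : List (Duel N)) (l : ℕ) (Z : Fin N) : Prop :=
  score h Z = ((N : ℤ) - 1) * (l : ℤ) ∧ ∀ i, i ≠ Z → score h i = -(l : ℤ)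

/-- WS-S is either in an exploration phase, running WS-W, or in an exploitation phase, with `r`
pulls of the pair `(Z, Z)` left. -/
inductive Phase (N : ℕ) where
  | explore : Phase N
  | exploit (Z : Fin N) (r : ℕ) : Phase N

/-- State of WS-S (Winner Stays for strong regret). -/
structure State (N : ℕ) where
  /-- the duels of the exploration phases so far, most recent first -/
  hist : List (Duel N)
  /-- the current round `ℓ ≥ 1` -/
  round : ℕ
  /-- the current phase -/
  phase : Phase N
  /-- all pairs of arms pulled so far, in both kinds of phases -/
  pulls : List (Fin N × Fin N)

/-- The state at the start of WS-S. -/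
def State.init (N : ℕ) : State N := ⟨[], 1, Phase.explore, []⟩

/-- The pair of arms that WS-S pulls next. -/
def State.nextPair {N : ℕ} [N.AtLeastTwo] (s : State N) : PMF (Fin N × Fin N) :=
  match s.phase with
  | Phase.explore => wswPair s.hist
  | Phase.exploit Z _ => PMF.pure (Z, Z)

open Classical in
/-- The state of WS-S with parameter `β` after pulling the pair `x` with feedback `b`. If an
exploration pull ends round `ℓ` with winner `Z`, the next `⌊β ^ ℓ⌋` pulls are of `(Z, Z)`, their
feedback is ignored, and then the next round starts. -/
def State.update {N : ℕ} (β : ℝ) (s : State N) (x : Fin N × Fin N) (b : Bool) : State N :=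
  match s.phase with
  | Phase.explore =>
    let h : List (Duel N) := ⟨x.1, x.2, b⟩ :: s.hist
    if hZ : ∃ Z, WinsRound h s.round Z then
      ⟨h, s.round, Phase.exploit hZ.choose ⌊β ^ s.round⌋₊, x :: s.pulls⟩
    else
      ⟨h, s.round, Phase.explore, x :: s.pulls⟩
  | Phase.exploit Z r =>
    if r ≤ 1 then ⟨s.hist, s.round + 1, Phase.explore, x :: s.pulls⟩
    else ⟨s.hist, s.round, Phase.exploit Z (r - 1), x :: s.pulls⟩

/-- The law of the state of WS-S with parameter `β` after `t` time periods. -/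
def wssLaw {N : ℕ} [N.AtLeastTwo] (P : Preference N) (β : ℝ) : ℕ → PMF (State N)
  | 0 => PMF.pure (State.init N)
  | t + 1 => (wssLaw P β t).bind fun s =>
      s.nextPair.bind fun x =>
        (P.feedback x.1 x.2).map fun b => s.update β x b

/-- Single-period strong regret of pulling the pair `x`: it is `0` if the best arm is pulled twice
and `1` otherwise. -/
def strongRegret {N : ℕ} [N.AtLeastTwo] (x : Fin N × Fin N) : ℕ :=
  if x = (0, 0) then 0 else 1

/-- Cumulative strong regret of all pulls so far. -/
def State.cumRegret {N : ℕ} [N.AtLeastTwo] (s : State N) : ℕ :=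
  (s.pulls.map strongRegret).sum

/-- Expected cumulative strong regret of WS-S with parameter `β` up to time `T`. -/
def wssExpectedRegret {N : ℕ} [N.AtLeastTwo] (P : Preference N) (β : ℝ) (T : ℕ) : ℝ≥0∞ :=
  ∑' s : State N, wssLaw P β T s * (s.cumRegret : ℝ≥0∞)

end DuelingBandit

end

/-! A potential on the states of WS-S is chosen so that past regret plus potential is a
supermartingale up to the horizon; induction on the periods left (`costBounds`) then bounds the
regret by the initial potential. Write `r = 2p - 1`, `ρ = (1 - p)/p` and `u = p/r = 1/(1 - ρ)`.

Within round `l`, tie-breaking keeps two arms dueling until one falls to score `-l`; the survivor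
then meets a uniformly random fresh arm (`Contest.wswPair_support`, `Reigns.expect_wswPair_le`). The
worse arm's distance `d` to defeat shrinks on average by at least `r` per duel, so `(d + R)/r` pays
for the duels, except that a challenge by a better arm raises `d` by up to `N l`. Better challengers
behave like records of a random order, so about `u` times a harmonic number of such challenges is
expected (`sum_challenges_le`). An upset, of probability at most `ρ^e`, renews these challenges; the
total reserve for upsets is geometric because the incumbent's distance to defeat grows by one per
contest.

Across rounds, let `C` be the score of the best arm. For `ρ ≤ z ≤ 1`, `z^C` is a supermartingale
(`zpow_drift`). With `z = ρ`, the best arm loses round `l` with probability at most `ρ^l`, so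
starting rounds with a wrong incumbent has summable cost. With `z = 1/β`, which is where `β <
p/(1-p)` enters, `z^C` equals `β^l` when round `l` is lost, so exploitation costs at most 1 per
round in expectation.

Each round thus adds at most `(N-1)/r + 1 ≤ N/r` to a fixed cost, and the last round `M` satisfies
`β^M ≤ T(β-1) + β`. The value `p = 1` is reached by continuity. -/

noncomputable section

namespace DuelingBandit

/-! ### Expectations under a `PMF` -/

/-- The expectation of a nonnegative function. -/
def expect {α : Type*} (μ : PMF α) (f : α → ℝ≥0∞) : ℝ≥0∞ := ∑' a, μ a * f a

theorem expect_bind {α γ : Type*} (μ : PMF α) (κ : α → PMF γ) (f : γ → ℝ≥0∞) :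
    expect (μ.bind κ) f = expect μ fun a => expect (κ a) f := by
  simp only [expect, PMF.bind_apply, ← ENNReal.tsum_mul_right, ← ENNReal.tsum_mul_left]
  rw [ENNReal.tsum_comm]
  simp only [mul_assoc]

theorem expect_pure {α : Type*} (a : α) (f : α → ℝ≥0∞) : expect (PMF.pure a) f = f a := by
  rw [expect, tsum_eq_single a]
  · simp
  · intro b hb
    simp [PMF.pure_apply, hb]

theorem expect_map {α γ : Type*} (μ : PMF α) (m : α → γ) (f : γ → ℝ≥0∞) :
    expect (μ.map m) f = expect μ fun a => f (m a) := by
  simp only [PMF.map, expect_bind, Function.comp, expect_pure]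

theorem expect_le {α : Type*} (μ : PMF α) (f : α → ℝ≥0∞) (v : ℝ≥0∞)
    (h : ∀ a ∈ μ.support, f a ≤ v) : expect μ f ≤ v := by
  calc expect μ f ≤ ∑' a, μ a * v := by
        refine ENNReal.tsum_le_tsum fun a => ?_
        by_cases ha : a ∈ μ.support
        · gcongr
          exact h a ha
        · rw [(PMF.apply_eq_zero_iff μ a).2 ha]
          simp
    _ = v := by rw [ENNReal.tsum_mul_right, PMF.tsum_coe, one_mul]

theorem expect_feedback {N : ℕ} (P : Preference N) (i j : Fin N) (f : Bool → ℝ≥0∞) :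
    expect (P.feedback i j) f
      = ENNReal.ofReal (P.prob i j) * f true + ENNReal.ofReal (P.prob j i) * f false := by
  simp [expect, Preference.feedback]

theorem expect_uniformOfFinset {α : Type*} (A : Finset α) (hA : A.Nonempty) (f : α → ℝ≥0∞) :
    expect (PMF.uniformOfFinset A hA) f = (A.card : ℝ≥0∞)⁻¹ * ∑ a ∈ A, f a := by
  rw [expect, tsum_eq_sum (s := A), Finset.mul_sum]
  · exact Finset.sum_congr rfl fun a ha => by rw [PMF.uniformOfFinset_apply_of_mem hA ha]
  · intro a ha
    rw [PMF.uniformOfFinset_apply_of_notMem hA ha, zero_mul]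

/-- The expected cumulative regret `n` periods later, starting from the state `s`. -/
def costToGo {N : ℕ} [N.AtLeastTwo] (P : Preference N) (β : ℝ) : ℕ → State N → ℝ≥0∞
  | 0, s => s.cumRegret
  | n + 1, s => expect s.nextPair fun x =>
      expect (P.feedback x.1 x.2) fun b => costToGo P β n (s.update β x b)

/-- The Markov property trades the forward law for a backward recursion, which allows induction on
the periods left from an arbitrary state. -/
theorem expect_wssLaw_add {N : ℕ} [N.AtLeastTwo] (P : Preference N) (β : ℝ) (n t : ℕ) :
    expect (wssLaw P β (t + n)) (costToGo P β 0) = expect (wssLaw P β t) (costToGo P β n) := by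
  induction n generalizing t with
  | zero => rfl
  | succ n ih =>
    rw [← add_assoc, add_right_comm, ih]
    simp only [wssLaw, expect_bind, expect_map, costToGo]

theorem wssExpectedRegret_eq_costToGo {N : ℕ} [N.AtLeastTwo] (P : Preference N) (β : ℝ) (T : ℕ) :
    wssExpectedRegret P β T = costToGo P β T (State.init N) := by
  have h := expect_wssLaw_add P β T 0
  rw [zero_add, wssLaw, expect_pure] at h
  exact h

/-! ### Scores and tie-breaking -/

theorem score_cons {N : ℕ} {δ : Duel N} {x y : Fin N} (hxy : x ≠ y) (hδ : δ.Defeats x y)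
    (h : List (Duel N)) (k : Fin N) :
    score (δ :: h) k = score h k + (if k = x then 1 else 0) - (if k = y then 1 else 0) := by
  have hw : ∀ i j, (wins (δ :: h) i j : ℤ) = wins h i j + if i = x ∧ j = y then 1 else 0 := by
    intro i j
    have hD : δ.Defeats i j ↔ (i = x ∧ j = y) := by
      obtain ⟨a, c, b⟩ := δ
      simp only [Duel.Defeats] at hδ ⊢
      cases b <;> simp at hδ ⊢ <;> obtain ⟨rfl, rfl⟩ := hδ <;> simp [eq_comm, and_comm]
    simp only [wins, List.countP_cons, hD]
    push_cast
    split_ifs <;> simp_all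
  simp only [score, hw]
  have e1 : ∑ j ∈ Finset.univ.erase k, (if k = x ∧ j = y then (1 : ℤ) else 0)
      = if k = x then 1 else 0 := by
    by_cases hk : k = x
    · subst hk
      simp [Finset.sum_ite_eq', Ne.symm hxy]
    · simp [hk]
  have e2 : ∑ j ∈ Finset.univ.erase k, (if j = x ∧ k = y then (1 : ℤ) else 0)
      = if k = y then 1 else 0 := by
    by_cases hk : k = y
    · subst hk
      simp [Finset.sum_ite_eq', hxy]
    · simp [hk]
  rw [← e1, ← e2, ← Finset.sum_add_distrib, ← Finset.sum_sub_distrib]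
  exact Finset.sum_congr rfl fun j _ => by ring

theorem mem_argmax {N : ℕ} {s : Finset (Fin N)} {C : Fin N → ℤ} {i : Fin N} :
    i ∈ argmax s C ↔ i ∈ s ∧ ∀ k ∈ s, C k ≤ C i := by
  simp [argmax]

theorem mem_of_mem_support_breakTie {N : ℕ} {A : Finset (Fin N)} {hA : A.Nonempty}
    {o : Option (Duel N)} {i : Fin N} (hi : i ∈ (breakTie A hA o).support) : i ∈ A := by
  cases o with
  | none => simpa [breakTie] using hi
  | some d =>
    simp only [breakTie] at hi
    split_ifs at hi with h1 h2
    · simp only [PMF.support_pure, Set.mem_singleton_iff] at hi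
      rwa [hi]
    · simp only [PMF.support_pure, Set.mem_singleton_iff] at hi
      rwa [hi]
    · simpa using hi

theorem eq_fst_or_snd_of_mem_support_breakTie {N : ℕ} {A : Finset (Fin N)} {hA : A.Nonempty}
    {d : Duel N} (hd : d.fst ∈ A ∨ d.snd ∈ A) {i : Fin N}
    (hi : i ∈ (breakTie A hA (some d)).support) : i = d.fst ∨ i = d.snd := by
  simp only [breakTie] at hi
  split_ifs at hi with h1 h2
  · simp only [PMF.support_pure, Set.mem_singleton_iff] at hi
    exact Or.inl hi
  · simp only [PMF.support_pure, Set.mem_singleton_iff] at hi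
    exact Or.inr hi
  · exact absurd hd (by tauto)

/-! ### Configurations of scores within a round -/

/-- In round `l`, the arms `x` and `y` are playing against each other, `x` (`y`) being `e` (`d`)
net losses away from defeat. The arms of `U` are yet to play in this round, the remaining arms
have been beaten. -/
structure Contest {N : ℕ} (h : List (Duel N)) (l : ℕ) (x y : Fin N) (U : Finset (Fin N))
    (e d : ℕ) : Prop where
  ne : x ≠ y
  left_notMem : x ∉ U
  right_notMem : y ∉ U
  score_left : score h x = e - l
  score_right : score h y = d - l
  fresh : ∀ k ∈ U, score h k = 1 - l
  beaten : ∀ k, k ∉ U → k ≠ x → k ≠ y → score h k = -l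
  -- Given the other fields, this says that all scores sum to zero.
  total : e + d + U.card = N * l

/-- In round `l`, arm `w` has won its contest and is `b` net losses away from defeat. The arms
of `U` are yet to play in this round, the remaining arms have been beaten. -/
structure Reigns {N : ℕ} (h : List (Duel N)) (l : ℕ) (w : Fin N) (U : Finset (Fin N))
    (b : ℕ) : Prop where
  notMem : w ∉ U
  score_eq : score h w = b - l
  fresh : ∀ k ∈ U, score h k = 1 - l
  beaten : ∀ k, k ∉ U → k ≠ w → score h k = -l
  total : b + U.card = N * l

/-! ### Evolution of configurations and the next pair shown -/

section Configurations

variable {N : ℕ} {h : List (Duel N)} {l : ℕ} {x y w : Fin N} {U : Finset (Fin N)} {e d b : ℕ}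

theorem Contest.swap (c : Contest h l x y U e d) : Contest h l y x U d e :=
  ⟨c.ne.symm, c.right_notMem, c.left_notMem, c.score_right, c.score_left, c.fresh,
    fun k hk hy hx => c.beaten k hk hx hy, by rw [← c.total]; ring⟩

theorem Contest.cons (c : Contest h l x y U e (d + 1)) {δ : Duel N} (hδ : δ.Defeats x y) :
    Contest (δ :: h) l x y U (e + 1) d := by
  have hs := score_cons c.ne hδ h
  refine ⟨c.ne, c.left_notMem, c.right_notMem, ?_, ?_, ?_, ?_, ?_⟩
  · rw [hs, c.score_left, if_pos rfl, if_neg c.ne]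
    push_cast
    ring
  · rw [hs, c.score_right, if_pos rfl, if_neg c.ne.symm]
    push_cast
    ring
  · intro k hk
    rw [hs, c.fresh k hk, if_neg (ne_of_mem_of_not_mem hk c.left_notMem),
      if_neg (ne_of_mem_of_not_mem hk c.right_notMem)]
    ring
  · intro k hk hx hy
    rw [hs, c.beaten k hk hx hy, if_neg hx, if_neg hy]
    ring
  · have := c.total
    omega

theorem Contest.reigns (c : Contest h l x y U e 0) : Reigns h l x U e := by
  refine ⟨c.left_notMem, c.score_left, c.fresh, fun k hk hx => ?_, by simpa using c.total⟩
  by_cases hy : k = y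
  · rw [hy, c.score_right]
    simp
  · exact c.beaten k hk hx hy

/-- Both contestants are still above `-l`, whereas a finished round leaves only one such arm. -/
theorem Contest.not_winsRound (c : Contest h l x y U (e + 1) (d + 1)) (z : Fin N) :
    ¬ WinsRound h l z := by
  intro hz
  have h1 := c.score_left
  have h2 := c.score_right
  push_cast at h1 h2
  by_cases hx : x = z
  · have := hz.2 y (fun h => c.ne (hx.trans h.symm))
    omega
  · have := hz.2 x hx
    omega

/-- With no arm left to play, `total` forces `b = N * l`, which is the winning score. -/
theorem Reigns.winsRound (c : Reigns h l w ∅ b) : WinsRound h l w := by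
  refine ⟨?_, fun i hi => c.beaten i (by simp) hi⟩
  have := c.total
  simp only [Finset.card_empty, add_zero] at this
  rw [c.score_eq, this]
  push_cast
  ring

theorem Reigns.contest (c : Reigns h l w U b) {a : Fin N} (ha : a ∈ U) :
    Contest h l w a (U.erase a) b 1 := by
  refine ⟨(ne_of_mem_of_not_mem ha c.notMem).symm, fun hw => c.notMem (Finset.mem_of_mem_erase hw),
    Finset.notMem_erase a U, c.score_eq, by simpa using c.fresh a ha,
    fun k hk => c.fresh k (Finset.mem_of_mem_erase hk), fun k hk hw ha' => ?_, ?_⟩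
  · exact c.beaten k (fun hU => hk (Finset.mem_erase.2 ⟨ha', hU⟩)) hw
  · have := c.total
    have h1 := Finset.card_pos.2 ⟨a, ha⟩
    rw [Finset.card_erase_of_mem ha]
    omega

theorem WinsRound.unique [N.AtLeastTwo] (hl : 1 ≤ l) (hx : WinsRound h l x)
    (hy : WinsRound h l y) : x = y := by
  by_contra hne
  have h1 := hx.1
  have h2 := hy.2 x hne
  have h3 : (2 : ℤ) ≤ N := by exact_mod_cast Nat.AtLeastTwo.prop (n := N)
  have h4 : (1 : ℤ) ≤ l := by exact_mod_cast hl
  nlinarith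

theorem Reigns.not_winsRound (c : Reigns h l w U (b + 1)) (hU : U.Nonempty) (z : Fin N) :
    ¬ WinsRound h l z := by
  intro hz
  obtain ⟨k, hk⟩ := hU
  have hne := ne_of_mem_of_not_mem hk c.notMem
  have h1 := c.fresh k hk
  have h2 := c.score_eq
  push_cast at h2
  by_cases hw : k = z
  · have := hz.2 w (fun h => hne (hw.trans h.symm))
    omega
  · have := hz.2 k hw
    omega

/-- Raising the level to `l + 1` puts every loser one net loss from defeat. The opponent is
arbitrary here; tie-breaking will single out the last one. -/
theorem WinsRound.contest [N.AtLeastTwo] (hz : WinsRound h l x) (hxy : x ≠ y) :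
    Contest h (l + 1) x y ((Finset.univ.erase x).erase y) (N * l + 1) 1 := by
  refine ⟨hxy, by simp, by simp, ?_, ?_, ?_, ?_, ?_⟩
  · rw [hz.1]
    push_cast
    ring
  · rw [hz.2 y hxy.symm]
    push_cast
    ring
  · intro k hk
    simp only [Finset.mem_erase, Finset.mem_univ, and_true] at hk
    rw [hz.2 k hk.2]
    push_cast
    ring
  · intro k hk hx hy
    simp [hx, hy] at hk
  · have := Nat.AtLeastTwo.prop (n := N)
    rw [Finset.card_erase_of_mem (by simp [hxy.symm]), Finset.card_erase_of_mem (by simp),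
      Finset.card_univ, Fintype.card_fin, mul_add]
    omega

theorem contest_nil [N.AtLeastTwo] (hxy : x ≠ y) :
    Contest [] 1 x y ((Finset.univ.erase x).erase y) 1 1 := by
  have hs : ∀ k : Fin N, score [] k = 0 := fun k => by simp [score, wins]
  refine ⟨hxy, by simp, by simp, by simp [hs], by simp [hs], by simp [hs], ?_, ?_⟩
  · intro k hk hx hy
    simp [hx, hy] at hk
  · have := Nat.AtLeastTwo.prop (n := N)
    rw [Finset.card_erase_of_mem (by simp [hxy.symm]), Finset.card_erase_of_mem (by simp),
      Finset.card_univ, Fintype.card_fin]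
    omega

/-- A fresh arm is exactly one above `-l`, a live contestant at least one above: fresh arms may tie
with a contestant but never overtake it. -/
theorem Contest.score_le (c : Contest h l x y U (e + 1) (d + 1)) {k : Fin N} (hx : k ≠ x) :
    score h k ≤ score h y := by
  have h2 := c.score_right
  push_cast at h2
  by_cases hy : k = y
  · rw [hy]
  · by_cases hk : k ∈ U
    · have := c.fresh k hk
      omega
    · have := c.beaten k hk hx hy
      omega

/-- The arms of an undecided contest play on. -/
theorem Contest.wswPair_support [N.AtLeastTwo] {δ : Duel N} {t : List (Duel N)}
    (c : Contest (δ :: t) l x y U (e + 1) (d + 1)) (hδ : δ.Defeats x y ∨ δ.Defeats y x)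
    {z : Fin N × Fin N} (hz : z ∈ (wswPair (δ :: t)).support) : z = (x, y) ∨ z = (y, x) := by
  have hfs : (δ.fst = x ∧ δ.snd = y) ∨ (δ.fst = y ∧ δ.snd = x) := by
    simp only [Duel.Defeats] at hδ
    tauto
  have key : ∀ A : Finset (Fin N), ∀ hA : A.Nonempty, (x ∈ A ∨ y ∈ A) → ∀ i,
      i ∈ (breakTie A hA (some δ)).support → (i = x ∨ i = y) := by
    intro A hA hxy i hi
    have := eq_fst_or_snd_of_mem_support_breakTie (by
      rcases hfs with ⟨h1, h2⟩ | ⟨h1, h2⟩ <;> rw [h1, h2] <;> tauto) hi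
    rcases hfs with ⟨h1, h2⟩ | ⟨h1, h2⟩ <;> rw [h1, h2] at this <;> tauto
  simp only [wswPair, PMF.mem_support_bind_iff, PMF.mem_support_map_iff, List.head?_cons] at hz
  obtain ⟨i, hi, j, hj, rfl⟩ := hz
  have hxy : x ∈ argmax Finset.univ (score (δ :: t)) ∨ y ∈ argmax Finset.univ (score (δ :: t)) := by
    rcases le_total (score (δ :: t) x) (score (δ :: t) y) with hle | hle
    · right
      refine mem_argmax.2 ⟨Finset.mem_univ _, fun k _ => ?_⟩
      by_cases hk : k = x
      · rwa [hk]
      · exact c.score_le hk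
    · left
      refine mem_argmax.2 ⟨Finset.mem_univ _, fun k _ => ?_⟩
      by_cases hk : k = y
      · rwa [hk]
      · exact c.swap.score_le hk
  have hi' := key _ _ hxy i hi
  have hji : j ≠ i := by
    have hjA := mem_of_mem_support_breakTie hj
    exact Finset.ne_of_mem_erase (mem_argmax.1 hjA).1
  rcases hi' with rfl | rfl
  · have hy : y ∈ argmax (Finset.univ.erase i) (score (δ :: t)) :=
      mem_argmax.2 ⟨by simp [c.ne.symm], fun k hk => c.score_le (by simpa using hk)⟩
    have := key _ _ (Or.inr hy) j hj
    left
    rcases this with rfl | rfl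
    · exact absurd rfl hji
    · rfl
  · have hx : x ∈ argmax (Finset.univ.erase i) (score (δ :: t)) :=
      mem_argmax.2 ⟨by simp [c.ne], fun k hk => c.swap.score_le (by simpa using hk)⟩
    have := key _ _ (Or.inl hx) j hj
    right
    rcases this with rfl | rfl
    · rfl
    · exact absurd rfl hji

/-- The winner of a contest is challenged by a uniformly random arm. -/
theorem Reigns.expect_wswPair_le [N.AtLeastTwo] {δ : Duel N} {t : List (Duel N)} {a : Fin N}
    (c : Reigns (δ :: t) l w U b) (hb : 2 ≤ b) (hU : U.Nonempty) (hδ : δ.Defeats w a)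
    (ha : a ∉ U) (f : Fin N × Fin N → ℝ≥0∞) :
    expect (wswPair (δ :: t)) f ≤ (U.card : ℝ≥0∞)⁻¹ * ∑ k ∈ U, f (w, k) := by
  -- Since `2 ≤ b`, the incumbent is strictly ahead even of the fresh arms.
  have hle : ∀ k, k ≠ w → score (δ :: t) k < score (δ :: t) w := by
    intro k hk
    rw [c.score_eq]
    by_cases hkU : k ∈ U
    · rw [c.fresh k hkU]
      omega
    · rw [c.beaten k hkU hk]
      omega
  have hne : ∀ k ∈ U, k ≠ w := fun k hk => ne_of_mem_of_not_mem hk c.notMem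
  have hA : argmax (Finset.univ.erase w) (score (δ :: t)) = U := by
    ext k
    rw [mem_argmax]
    constructor
    · rintro ⟨hk, hmax⟩
      by_contra hkU
      obtain ⟨j, hj⟩ := hU
      have := hmax j (by simpa using hne j hj)
      rw [c.fresh j hj, c.beaten k hkU (by simpa using hk)] at this
      omega
    · intro hk
      refine ⟨by simpa using hne k hk, fun j hj => ?_⟩
      rw [c.fresh k hk]
      by_cases hjU : j ∈ U
      · rw [c.fresh j hjU]
      · rw [c.beaten j hjU (by simpa using hj)]
        omega
  rw [wswPair, expect_bind]
  refine expect_le _ _ _ fun i hi => ?_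
  have hiw : i = w := by
    by_contra hne'
    have hiA := mem_of_mem_support_breakTie hi
    have := (mem_argmax.1 hiA).2 w (Finset.mem_univ w)
    exact absurd this (not_le.2 (hle i hne'))
  subst hiw
  -- Neither arm of the last duel is among the tied ones, so the tie-break falls through to the
  -- uniform draw.
  have hfs : δ.fst ∉ U ∧ δ.snd ∉ U := by
    have h1 := c.notMem
    rcases hδ with ⟨h2, h3, _⟩ | ⟨h2, h3, _⟩ <;> rw [h2, h3] <;> tauto
  rw [expect_map]
  simp only [hA, List.head?_cons, breakTie, if_neg hfs.1, if_neg hfs.2]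
  rw [expect_uniformOfFinset]

end Configurations

/-! ### The potential -/

/-- The ranks in `V` run through an initial segment of `ℕ`: a new maximum leaves the earlier ranks
unchanged. -/
theorem sum_card_filter_lt {N : ℕ} (V : Finset (Fin N)) (g : ℕ → ℝ) :
    ∑ c ∈ V, g (V.filter (· < c)).card = ∑ k ∈ Finset.range V.card, g k := by
  induction V using Finset.induction_on_max with
  | empty => simp
  | insert a s ha ih =>
    have hna : a ∉ s := fun h => lt_irrefl _ (ha a h)
    rw [Finset.sum_insert hna, Finset.card_insert_of_notMem hna, Finset.sum_range_succ, ← ih,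
      add_comm]
    congr 1
    · refine Finset.sum_congr rfl fun c hc => ?_
      rw [Finset.filter_insert, if_neg (not_lt.2 (ha c hc).le)]
    · rw [Finset.filter_insert, if_neg (lt_irrefl a), Finset.filter_true_of_mem ha]

theorem sum_range_harmonic (n : ℕ) :
    ∑ k ∈ Finset.range n, (harmonic k : ℝ) = n * (harmonic n : ℝ) - n := by
  induction n with
  | zero => simp
  | succ n ih =>
    rw [Finset.sum_range_succ, ih, harmonic_succ]
    push_cast
    field_simp
    ring

theorem harmonic_mono : Monotone fun n => (harmonic n : ℝ) := by
  refine monotone_nat_of_le_succ fun n => ?_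
  simp only [harmonic_succ]
  push_cast
  have : (0 : ℝ) ≤ ((n : ℝ) + 1)⁻¹ := by positivity
  linarith

/-- The ratio of the probabilities of a defeat and a win for the better arm. -/
def upsetRatio (p : ℝ) : ℝ := (1 - p) / p

/-- A bound on the expected number of further challenges of an arm by a better arm, if `k` better
arms are yet to play. -/
def challenges (p : ℝ) (k : ℕ) : ℝ := p / (2 * p - 1) * (harmonic k : ℝ)

/-- Potential of the rounds after round `l`, the best arm having score `c`. The number of rounds
is at most `M`. -/
def afterRound (p β : ℝ) (N M l : ℕ) (c : ℤ) : ℝ :=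
  (N - 1) / (2 * p - 1) * (M - l) + (M - l) * β⁻¹ ^ c
    + N / (2 * p - 1) * (1 + p / (2 * p - 1) * challenges p (N - 1))
      * (upsetRatio p ^ l * (l * (p / (2 * p - 1)) + (p / (2 * p - 1)) ^ 2)) * upsetRatio p ^ c

/-- Potential of the remaining part of round `l` during a contest. There are `R` arms yet to play
in this round. The better arm of the contest is `e` net losses away from defeat, and the worse one
`d` net losses. If they win, then there are `K` and `K'` better arms, respectively, yet to play. -/
def contestCost (p : ℝ) (N l R K K' e d : ℕ) : ℝ :=
  (d + R) / (2 * p - 1) + N * l / (2 * p - 1) * (challenges p K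
    + upsetRatio p ^ e * (challenges p K' - challenges p K)
    + challenges p (N - 1) * (p / (2 * p - 1)) * upsetRatio p ^ (d + e))

/-- Potential of the remaining part of round `l` after a contest. There are `R` arms yet to play
in this round, `K` of which are better than the winner of the contest, who is `b` net losses away
from defeat. -/
def reignCost (p : ℝ) (N l R K b : ℕ) : ℝ :=
  R / (2 * p - 1) + N * l / (2 * p - 1) *
    (challenges p K + challenges p (N - 1) * (p / (2 * p - 1)) * upsetRatio p ^ b)

/-! ### Drift inequalities of the potential -/

section Potential

variable {p β : ℝ} (hp : 1 / 2 < p) (hp1 : p < 1)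

include hp

/-- This is `u = 1 / (1 - ρ)` cleared of denominators; the geometric sums in the potential telescope
through it. -/
theorem upsetRatio_eq : 1 + p / (2 * p - 1) * upsetRatio p = p / (2 * p - 1) := by
  have hr : 2 * p - 1 ≠ 0 := by linarith
  have hp0 : p ≠ 0 := by linarith
  have h : p / (2 * p - 1) * upsetRatio p = (1 - p) / (2 * p - 1) := by
    rw [upsetRatio, mul_comm]
    exact div_mul_div_cancel₀ hp0
  rw [h, eq_div_iff hr, add_mul, div_mul_cancel₀ _ hr]
  ring

theorem challenges_nonneg (k : ℕ) : 0 ≤ challenges p k := by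
  have h1 : 0 ≤ (harmonic k : ℝ) := by
    have := harmonic_mono (Nat.zero_le k)
    simpa using this
  have h2 : 0 ≤ 2 * p - 1 := by linarith
  exact mul_nonneg (div_nonneg (by linarith) h2) h1

theorem challenges_mono : Monotone (challenges p) := fun a b h =>
  mul_le_mul_of_nonneg_left (harmonic_mono h) (div_nonneg (by linarith) (by linarith))

/-- The factor `ρ^l (l u + u²)` is the tail of `∑ (j + 1) ρ^j` over `j ≥ l`; its first term is the
charge for round `l + 1`. -/
theorem afterRound_eq (N M l : ℕ) (c : ℤ) :
    afterRound p β N M l c = (N - 1) / (2 * p - 1)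
      + N * (l + 1 : ℕ) / (2 * p - 1) * (1 + p / (2 * p - 1) * challenges p (N - 1))
        * (upsetRatio p ^ l * upsetRatio p ^ c)
      + β⁻¹ ^ c + afterRound p β N M (l + 1) c := by
  have hu := upsetRatio_eq hp
  have hr : 2 * p - 1 ≠ 0 := by linarith
  simp only [afterRound]
  set u := p / (2 * p - 1)
  set ρ := upsetRatio p
  have e : ρ ^ l * (l * u + u ^ 2)
      = (l + 1 : ℕ) * ρ ^ l + ρ ^ (l + 1) * ((l + 1 : ℕ) * u + u ^ 2) := by
    push_cast
    rw [pow_succ]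
    linear_combination (-(ρ ^ l) * (l + 1 + u)) * hu
  rw [e]
  push_cast
  ring

/-- At `e = 0` the upset term replaces `challenges p K` by `challenges p K'` exactly; only `d / (2 *
p - 1)` is given away. -/
theorem reignCost_le_contestCost_right (N l R K K' d : ℕ) :
    reignCost p N l R K' d ≤ contestCost p N l R K K' 0 d := by
  have hr : 0 < 2 * p - 1 := by linarith
  have hA : 0 ≤ d / (2 * p - 1) := by positivity
  simp only [contestCost, reignCost, pow_zero, add_zero]
  linear_combination hA

include hp1

theorem upsetRatio_pos : 0 < upsetRatio p := div_pos (by linarith) (by linarith)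

theorem upsetRatio_lt_one : upsetRatio p < 1 := by
  rw [upsetRatio, div_lt_one] <;> linarith

/-- The recursion behind `challenges`: a random better challenger leaves `k < K` better arms to play
if it wins; starting one loss from defeat, it fails with weight `ρ`, and then `K - 1` remain. As `(1
- ρ) u = 1`, the summation formula for harmonic numbers solves it. -/
theorem sum_challenges_le (K : ℕ) :
    ∑ k ∈ Finset.range K, (1 + challenges p k
      + upsetRatio p * (challenges p (K - 1) - challenges p k)) ≤ K * challenges p K := by
  have hρ := upsetRatio_pos hp hp1
  have hsum : ∑ k ∈ Finset.range K, challenges p k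
      = p / (2 * p - 1) * (K * (harmonic K : ℝ) - K) := by
    rw [← sum_range_harmonic, Finset.mul_sum]
    rfl
  have hmono := challenges_mono hp (Nat.sub_le K 1)
  have hu := upsetRatio_eq hp
  have e : ∑ k ∈ Finset.range K, (1 + challenges p k
      + upsetRatio p * (challenges p (K - 1) - challenges p k))
      = K + (1 - upsetRatio p) * ∑ k ∈ Finset.range K, challenges p k
        + upsetRatio p * (K * challenges p (K - 1)) := by
    rw [Finset.mul_sum]
    simp only [mul_sub, sub_mul, one_mul, Finset.sum_add_distrib, Finset.sum_sub_distrib,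
      Finset.sum_const, Finset.card_range, nsmul_eq_mul, mul_one]
    ring
  have h1 : (1 - upsetRatio p) * (p / (2 * p - 1)) = 1 := by linear_combination -hu
  have h2 : upsetRatio p * (K * challenges p (K - 1)) ≤ upsetRatio p * (K * challenges p K) := by
    gcongr
  rw [e, hsum, ← mul_assoc, h1, one_mul]
  have h3 : K * challenges p K * (1 - upsetRatio p) = K * (harmonic K : ℝ) := by
    rw [challenges]
    linear_combination (K * (harmonic K : ℝ)) * h1
  nlinarith

theorem afterRound_nonneg (hβ : 0 < β) {N M l : ℕ} (hN : 1 ≤ N) (hl : l ≤ M) (c : ℤ) :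
    0 ≤ afterRound p β N M l c := by
  have hρ := upsetRatio_pos hp hp1
  have hF := challenges_nonneg hp (N - 1)
  have hr : 0 < 2 * p - 1 := by linarith
  have hp0 : 0 < p := by linarith
  have h1 : (0 : ℝ) ≤ M - l := sub_nonneg.2 (by exact_mod_cast hl)
  have h2 : (0 : ℝ) ≤ N - 1 := sub_nonneg.2 (by exact_mod_cast hN)
  unfold afterRound
  positivity

theorem contestCost_nonneg (N l R e d : ℕ) {K K' : ℕ} (hK : K ≤ K') :
    0 ≤ contestCost p N l R K K' e d := by
  have hρ := upsetRatio_pos hp hp1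
  have hF := challenges_nonneg hp (N - 1)
  have hr : 0 < 2 * p - 1 := by linarith
  have hp0 : 0 < p := by linarith
  have h1 := challenges_nonneg hp K
  have h2 := sub_nonneg.2 (challenges_mono hp hK)
  unfold contestCost
  positivity

/-- Dividing by `z ^ (c - 1)` leaves `(z - 1) (q z - (1 - q)) ≤ 0`, whose roots are `1` and `(1 - q)
/ q ≤ upsetRatio p`. Integer exponents are needed because scores go negative. -/
theorem zpow_drift {q z : ℝ} (hq : p ≤ q) (hz : upsetRatio p ≤ z) (hz1 : z ≤ 1) (c : ℤ) :
    q * z ^ (c + 1) + (1 - q) * z ^ (c - 1) ≤ z ^ c := by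
  have hz0 : 0 < z := (upsetRatio_pos hp hp1).trans_le hz
  rw [upsetRatio, div_le_iff₀ (by linarith)] at hz
  have e : z ^ c = z * z ^ (c - 1) := by
    rw [zpow_sub_one₀ hz0.ne']
    field_simp
  rw [zpow_add_one₀ hz0.ne', e]
  have h0 : 0 < z ^ (c - 1) := zpow_pos hz0 _
  have h2 : q * z * z + (1 - q) ≤ z := by
    nlinarith [mul_nonneg hz0.le (sub_nonneg.2 hq)]
  calc q * (z * z ^ (c - 1) * z) + (1 - q) * z ^ (c - 1)
      = (q * z * z + (1 - q)) * z ^ (c - 1) := by ring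
    _ ≤ z * z ^ (c - 1) := by gcongr

/-- A nonnegative combination of `zpow_drift` for `z = β⁻¹` and `z = ρ`. The separate `β⁻¹ ^ c` is
the reserve for exploitation in the current round. -/
theorem afterRound_drift (hβ : 1 < β) (hβp : β * (1 - p) ≤ p) {q : ℝ} (hq : p ≤ q) {N M l : ℕ}
    (hl : l ≤ M) (c : ℤ) :
    q * (β⁻¹ ^ (c + 1) + afterRound p β N M l (c + 1))
      + (1 - q) * (β⁻¹ ^ (c - 1) + afterRound p β N M l (c - 1))
      ≤ β⁻¹ ^ c + afterRound p β N M l c := by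
  have hρ := upsetRatio_pos hp hp1
  have hF := challenges_nonneg hp (N - 1)
  have hr : 0 < 2 * p - 1 := by linarith
  have hp0 : 0 < p := by linarith
  have h1 : (0 : ℝ) ≤ M - l := sub_nonneg.2 (by exact_mod_cast hl)
  have hz : upsetRatio p ≤ β⁻¹ := by
    rw [upsetRatio, div_le_iff₀ hp0, inv_mul_eq_div, le_div_iff₀ (by linarith)]
    linarith
  have d1 := zpow_drift hp hp1 hq hz (inv_le_one_of_one_le₀ hβ.le) c
  have d2 := zpow_drift hp hp1 hq le_rfl (upsetRatio_lt_one hp hp1).le c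
  have hB : 0 ≤ N / (2 * p - 1) * (1 + p / (2 * p - 1) * challenges p (N - 1))
      * (upsetRatio p ^ l * (l * (p / (2 * p - 1)) + (p / (2 * p - 1)) ^ 2)) := by positivity
  simp only [afterRound]
  have m1 := mul_le_mul_of_nonneg_left d1 (add_nonneg zero_le_one h1)
  have m2 := mul_le_mul_of_nonneg_left d2 hB
  linear_combination m1 + m2

/-- The mean decrease `2q - 1 ≥ 2p - 1` of `d` pays for the duel, the term in `ρ ^ e` is a
supermartingale, and the last term is constant because `d + e` is. -/
theorem contestCost_drift {q : ℝ} (hq : p ≤ q) (N l R e d : ℕ) {K K' : ℕ} (hK : K ≤ K') :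
    q * contestCost p N l R K K' (e + 2) d + (1 - q) * contestCost p N l R K K' e (d + 2) + 1
      ≤ contestCost p N l R K K' (e + 1) (d + 1) := by
  have hρ := upsetRatio_pos hp hp1
  have hr : 0 < 2 * p - 1 := by linarith
  have hK' := sub_nonneg.2 (challenges_mono hp hK)
  have hd := zpow_drift hp hp1 hq le_rfl (upsetRatio_lt_one hp hp1).le (e + 1)
  have e1 : upsetRatio p ^ ((e : ℤ) + 1 + 1) = upsetRatio p ^ (e + 2) := by
    rw [← zpow_natCast]
    congr 1
  have e2 : upsetRatio p ^ ((e : ℤ) + 1 - 1) = upsetRatio p ^ e := by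
    rw [← zpow_natCast]
    congr 1
    ring
  have e3 : upsetRatio p ^ ((e : ℤ) + 1) = upsetRatio p ^ (e + 1) := by
    rw [← zpow_natCast]
    congr 1
  rw [e1, e2, e3] at hd
  have hA : 0 ≤ N * l / (2 * p - 1) * (challenges p K' - challenges p K) := by positivity
  have m := mul_le_mul_of_nonneg_left hd hA
  have h1 : (2 * p - 1) / (2 * p - 1) = 1 := div_self hr.ne'
  have h2 : (2 * p - 1) / (2 * p - 1) ≤ (2 * q - 1) / (2 * p - 1) := by gcongr
  simp only [contestCost]
  rw [show d + (e + 2) = d + 1 + (e + 1) by ring, show d + 2 + e = d + 1 + (e + 1) by ring]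
  push_cast
  rw [h1] at h2
  linear_combination m + h2

theorem reignCost_le_contestCost_left (N l R e : ℕ) {K K' : ℕ} (hK : K ≤ K') :
    reignCost p N l R K e ≤ contestCost p N l R K K' e 0 := by
  have hρ := upsetRatio_pos hp hp1
  have hr : 0 < 2 * p - 1 := by linarith
  have hK' := sub_nonneg.2 (challenges_mono hp hK)
  have hA : 0 ≤ N * l / (2 * p - 1) * (upsetRatio p ^ e * (challenges p K' - challenges p K)) := by
    positivity
  simp only [contestCost, reignCost, zero_add, Nat.cast_zero]
  linear_combination hA

theorem reignCost_nonneg (N l R K b : ℕ) : 0 ≤ reignCost p N l R K b := by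
  have hρ := upsetRatio_pos hp hp1
  have hF := challenges_nonneg hp (N - 1)
  have hr : 0 < 2 * p - 1 := by linarith
  have hp0 : 0 < p := by linarith
  have h1 := challenges_nonneg hp K
  unfold reignCost
  positivity

/-- A contest in which the winner of the previous one is the better arm. -/
theorem contestCost_worse_challenger_le {N : ℕ} (l R b K : ℕ) {K' : ℕ} (hK' : K' ≤ N - 1) :
    contestCost p N l R K K' b 1 ≤ (R + 1) / (2 * p - 1) + N * l / (2 * p - 1) *
      (challenges p K + challenges p (N - 1) * (p / (2 * p - 1)) * upsetRatio p ^ b) := by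
  have hρ := upsetRatio_pos hp hp1
  have hr : 0 < 2 * p - 1 := by linarith
  have h1 := challenges_nonneg hp K
  have h2 := challenges_mono hp hK'
  have hu := upsetRatio_eq hp
  -- The geometric reserve splits into the price of an upset in this contest and the reserve for
  -- later ones.
  have e : challenges p (N - 1) * (p / (2 * p - 1)) * upsetRatio p ^ b
      = challenges p (N - 1) * upsetRatio p ^ b
        + challenges p (N - 1) * (p / (2 * p - 1)) * upsetRatio p ^ (1 + b) := by
    rw [pow_add, pow_one]
    linear_combination (-challenges p (N - 1) * upsetRatio p ^ b) * hu
  rw [e, contestCost, Nat.cast_one, add_comm (1 : ℝ)]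
  have h3 : challenges p K' - challenges p K ≤ challenges p (N - 1) := by linarith
  have h4 := mul_le_mul_of_nonneg_left h3 (pow_pos hρ b).le
  have hA : (0 : ℝ) ≤ N * l / (2 * p - 1) := by positivity
  have h5 := mul_le_mul_of_nonneg_left h4 hA
  linear_combination h5

/-- A contest in which the winner of the previous one is the worse arm. -/
theorem contestCost_better_challenger_le {N l R b : ℕ} (hb : b ≤ N * l + 1) (K K' : ℕ) :
    contestCost p N l R K K' 1 b ≤ (R + 1) / (2 * p - 1) + N * l / (2 * p - 1) *
      (1 + challenges p K + upsetRatio p * (challenges p K' - challenges p K)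
        + challenges p (N - 1) * (p / (2 * p - 1)) * upsetRatio p ^ b) := by
  have hρ := upsetRatio_pos hp hp1
  have hr : 0 < 2 * p - 1 := by linarith
  have hp0 : 0 < p := by linarith
  have hF := challenges_nonneg hp (N - 1)
  have h1 : (b : ℝ) ≤ N * l + 1 := by exact_mod_cast hb
  -- The excess of `b` over 1 is at most `N * l`, the price of one challenge by a better arm.
  have h2 : (b : ℝ) / (2 * p - 1) ≤ (N * l + 1) / (2 * p - 1) := by gcongr
  have h3 : upsetRatio p ^ (b + 1) ≤ upsetRatio p ^ b :=
    pow_le_pow_of_le_one hρ.le (upsetRatio_lt_one hp hp1).le (Nat.le_succ b)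
  have hA : (0 : ℝ) ≤ N * l / (2 * p - 1) * (challenges p (N - 1) * (p / (2 * p - 1))) := by
    positivity
  have h4 := mul_le_mul_of_nonneg_left h3 hA
  simp only [contestCost, pow_one]
  linear_combination h2 + h4

end Potential

/-! ### The potential bounds the expected regret to come -/

/-- The number of arms in `U` that are better than `x`. -/
def numBetter {N : ℕ} (U : Finset (Fin N)) (x : Fin N) : ℕ := (U.filter (· < x)).card

theorem numBetter_mono {N : ℕ} (U : Finset (Fin N)) : Monotone (numBetter U) := fun x y h =>
  Finset.card_le_card fun k hk => by
    rw [Finset.mem_filter] at hk ⊢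
    exact ⟨hk.1, hk.2.trans_le h⟩

theorem numBetter_le {N : ℕ} {U : Finset (Fin N)} {x : Fin N} (hx : x ∉ U) (y : Fin N) :
    numBetter U y ≤ N - 1 := by
  have h1 : (U.filter (· < y)).card ≤ (Finset.univ.erase x).card :=
    Finset.card_le_card fun k hk =>
      Finset.mem_erase.2 ⟨ne_of_mem_of_not_mem (Finset.mem_filter.1 hk).1 hx, Finset.mem_univ k⟩
  rwa [Finset.card_erase_of_mem (Finset.mem_univ x), Finset.card_univ, Fintype.card_fin] at h1

/-- A lower bound on the number of periods before round `l`. -/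
def minTime (β : ℝ) (l : ℕ) : ℕ := ∑ i ∈ Finset.Ico 1 l, (⌊β ^ i⌋₊ + 1)

theorem minTime_succ (β : ℝ) {l : ℕ} (hl : 1 ≤ l) :
    minTime β (l + 1) = minTime β l + (⌊β ^ l⌋₊ + 1) :=
  Finset.sum_Ico_succ_top hl _

/-- The cumulative strong regret of a list of pulls. -/
def regretOf {N : ℕ} [N.AtLeastTwo] (π : List (Fin N × Fin N)) : ℕ := (π.map strongRegret).sum

theorem regretOf_cons {N : ℕ} [N.AtLeastTwo] (z : Fin N × Fin N) (π : List (Fin N × Fin N)) :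
    regretOf (z :: π) = strongRegret z + regretOf π := by
  simp [regretOf]

theorem strongRegret_of_ne {N : ℕ} [N.AtLeastTwo] {z : Fin N × Fin N} (hz : z.1 ≠ z.2) :
    strongRegret z = 1 := by
  rw [strongRegret, if_neg]
  rintro rfl
  exact hz rfl

theorem update_explore_of_forall_not {N : ℕ} (β : ℝ) {t : List (Duel N)} {l : ℕ}
    {z : Fin N × Fin N} {b : Bool} (π : List (Fin N × Fin N))
    (h : ∀ a, ¬ WinsRound (⟨z.1, z.2, b⟩ :: t) l a) :
    State.update β ⟨t, l, .explore, π⟩ z b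
      = ⟨⟨z.1, z.2, b⟩ :: t, l, .explore, z :: π⟩ := by
  simp only [State.update]
  rw [dif_neg (not_exists.2 h)]

theorem update_explore_of_winsRound {N : ℕ} [N.AtLeastTwo] (β : ℝ) {t : List (Duel N)} {l : ℕ}
    {z : Fin N × Fin N} {b : Bool} (π : List (Fin N × Fin N)) {a : Fin N} (hl : 1 ≤ l)
    (h : WinsRound (⟨z.1, z.2, b⟩ :: t) l a) :
    State.update β ⟨t, l, .explore, π⟩ z b
      = ⟨⟨z.1, z.2, b⟩ :: t, l, .exploit a ⌊β ^ l⌋₊, z :: π⟩ := by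
  have hex : ∃ a, WinsRound (⟨z.1, z.2, b⟩ :: t) l a := ⟨a, h⟩
  simp only [State.update]
  rw [dif_pos hex, WinsRound.unique hl hex.choose_spec h]

/-! ### The induction hypothesis and the effect of one duel -/

section Induction

variable {N : ℕ} [N.AtLeastTwo] (P : Preference N) (p β : ℝ) (T M : ℕ)

/-- Bounds on the expected regret after `n` more periods, `T` being the horizon. -/
structure CostBounds (n : ℕ) : Prop where
  contest : ∀ (δ : Duel N) (t : List (Duel N)) (l : ℕ) (π : List (Fin N × Fin N)) (x y : Fin N)
    (U : Finset (Fin N)) (e d : ℕ), x < y → Contest (δ :: t) l x y U (e + 1) (d + 1) →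
    (δ.Defeats x y ∨ δ.Defeats y x) → 1 ≤ l → minTime β l + n ≤ T →
    costToGo P β n ⟨δ :: t, l, .explore, π⟩ ≤ regretOf π + ENNReal.ofReal
      (contestCost p N l U.card (numBetter U x) (numBetter U y) (e + 1) (d + 1)
        + (β⁻¹ ^ score (δ :: t) 0 + afterRound p β N M l (score (δ :: t) 0)))
  reign : ∀ (δ : Duel N) (t : List (Duel N)) (l : ℕ) (π : List (Fin N × Fin N)) (w a : Fin N)
    (U : Finset (Fin N)) (b : ℕ), Reigns (δ :: t) l w U b → 2 ≤ b → U.Nonempty →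
    δ.Defeats w a → a ∉ U → 1 ≤ l → minTime β l + n ≤ T →
    costToGo P β n ⟨δ :: t, l, .explore, π⟩ ≤ regretOf π + ENNReal.ofReal
      (reignCost p N l U.card (numBetter U w) b
        + (β⁻¹ ^ score (δ :: t) 0 + afterRound p β N M l (score (δ :: t) 0)))
  -- `minTime β (l + 1)` already counts all pulls of round `l`, of which `k` are yet to come.
  exploit : ∀ (δ : Duel N) (t : List (Duel N)) (l : ℕ) (π : List (Fin N × Fin N)) (z a : Fin N)
    (k : ℕ), WinsRound (δ :: t) l z → δ.Defeats z a → z ≠ a → 1 ≤ l → 1 ≤ k →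
    k ≤ ⌊β ^ l⌋₊ → minTime β (l + 1) + n ≤ T + k →
    costToGo P β n ⟨δ :: t, l, .exploit z k, π⟩ ≤ regretOf π + ENNReal.ofReal
      ((if z = 0 then 0 else (k : ℝ)) + afterRound p β N M l (score (δ :: t) 0))

variable {P p β T M} (hp : 1 / 2 < p) (hp1 : p < 1) (hβ : 1 < β) (hβp : β * (1 - p) ≤ p)
  (hP : ∀ i j, i < j → p ≤ P.prob i j) (hM : ∀ l, minTime β l ≤ T → l ≤ M)

include hp hp1 hβ in
/-- The state after a duel won by `a` is a contest, or else its cost is bounded by that of the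
reign of `a`. -/
theorem costToGo_update_le {n : ℕ} (ih : CostBounds P p β T M n) {t : List (Duel N)} {l : ℕ}
    {a c : Fin N} {U : Finset (Fin N)} {e d : ℕ} (hc : Contest t l a c U (e + 1) (d + 1))
    {z : Fin N × Fin N} {b : Bool} (hz : Duel.Defeats ⟨z.1, z.2, b⟩ a c) (hl : 1 ≤ l)
    (hT : minTime β l + (n + 1) ≤ T) (π : List (Fin N × Fin N)) (v : ℝ)
    (hcontest : ∀ d', d = d' + 1 → costToGo P β n ⟨⟨z.1, z.2, b⟩ :: t, l, .explore, z :: π⟩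
      ≤ regretOf (z :: π) + ENNReal.ofReal v)
    (hreign : d = 0 → reignCost p N l U.card (numBetter U a) (e + 2)
      + (β⁻¹ ^ score (⟨z.1, z.2, b⟩ :: t) 0
        + afterRound p β N M l (score (⟨z.1, z.2, b⟩ :: t) 0)) ≤ v) :
    costToGo P β n (State.update β ⟨t, l, .explore, π⟩ z b)
      ≤ regretOf (z :: π) + ENNReal.ofReal v := by
  have hc' := hc.cons hz
  have hβ0 : 0 < β := by linarith
  rcases d with _ | d'
  · have hr := hc'.reigns
    refine le_trans ?_ (add_le_add_right (ENNReal.ofReal_le_ofReal (hreign rfl)) _)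
    rcases U.eq_empty_or_nonempty with rfl | hU
    · have hw := hr.winsRound
      rw [update_explore_of_winsRound β π hl hw]
      refine (ih.exploit _ t l (z :: π) a c _ hw hz hc.ne hl ?_ le_rfl ?_).trans ?_
      · exact Nat.le_floor (by simpa using one_le_pow₀ hβ.le)
      · rw [minTime_succ β hl]
        omega
      · refine add_le_add_right (ENNReal.ofReal_le_ofReal ?_) _
        have h1 := reignCost_nonneg hp hp1 N l (∅ : Finset (Fin N)).card (numBetter ∅ a) (e + 2)
        -- If the best arm has lost the round, its score is `-l` and the reserve equals `β ^ l`.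
        have h2 : (if a = 0 then 0 else (⌊β ^ l⌋₊ : ℝ)) ≤ β⁻¹ ^ score (⟨z.1, z.2, b⟩ :: t) 0 := by
          split_ifs with ha
          · positivity
          · rw [hw.2 0 (Ne.symm ha), zpow_neg, inv_zpow, inv_inv, zpow_natCast]
            exact Nat.floor_le (by positivity)
        linarith
    · rw [update_explore_of_forall_not β π (Reigns.not_winsRound hr hU)]
      exact ih.reign _ t l (z :: π) a c U _ hr (by omega) hU hz hc.right_notMem hl (by omega)
  · rw [update_explore_of_forall_not β π hc'.not_winsRound]
    exact hcontest d' rfl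

/-- Transfers a real drift inequality to `ℝ≥0∞`; `c` stands for the regret so far and `1` for the
present duel. -/
theorem ofReal_average_le {q a b v : ℝ} (c : ℝ≥0∞) {f g : ℝ≥0∞} (hq : 0 ≤ q) (hq1 : q ≤ 1)
    (ha : 0 ≤ a) (hb : 0 ≤ b) (hf : f ≤ 1 + c + ENNReal.ofReal a)
    (hg : g ≤ 1 + c + ENNReal.ofReal b) (hv : q * a + (1 - q) * b + 1 ≤ v) :
    ENNReal.ofReal q * f + ENNReal.ofReal (1 - q) * g ≤ c + ENNReal.ofReal v := by
  have hq' : 0 ≤ 1 - q := by linarith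
  have hsum : ENNReal.ofReal q + ENNReal.ofReal (1 - q) = 1 := by
    rw [← ENNReal.ofReal_add hq hq']
    simp
  calc ENNReal.ofReal q * f + ENNReal.ofReal (1 - q) * g
      ≤ ENNReal.ofReal q * (1 + c + ENNReal.ofReal a)
        + ENNReal.ofReal (1 - q) * (1 + c + ENNReal.ofReal b) := by gcongr
    _ = (ENNReal.ofReal q + ENNReal.ofReal (1 - q)) * (1 + c)
        + (ENNReal.ofReal q * ENNReal.ofReal a + ENNReal.ofReal (1 - q) * ENNReal.ofReal b) := by
      ring
    _ = c + ENNReal.ofReal (q * a + (1 - q) * b + 1) := by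
      rw [hsum, one_mul, ← ENNReal.ofReal_mul hq, ← ENNReal.ofReal_mul hq',
        ← ENNReal.ofReal_add (mul_nonneg hq ha) (mul_nonneg hq' hb),
        ENNReal.ofReal_add (add_nonneg (mul_nonneg hq ha) (mul_nonneg hq' hb)) zero_le_one,
        ENNReal.ofReal_one]
      ring
    _ ≤ c + ENNReal.ofReal v := by gcongr

include hp hp1 hβ hβp hP hM in
/-- The regret expected before a duel of the arms `x < y`. -/
theorem expect_feedback_le {n : ℕ} (ih : CostBounds P p β T M n) {t : List (Duel N)} {l : ℕ}
    {x y : Fin N} {U : Finset (Fin N)} {e d : ℕ} (hxy : x < y)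
    (hc : Contest t l x y U (e + 1) (d + 1)) {z : Fin N × Fin N} (hz : z = (x, y) ∨ z = (y, x))
    (hl : 1 ≤ l) (hT : minTime β l + (n + 1) ≤ T) (π : List (Fin N × Fin N)) :
    expect (P.feedback z.1 z.2) (fun b => costToGo P β n (State.update β ⟨t, l, .explore, π⟩ z b))
      ≤ regretOf π + ENNReal.ofReal
        (contestCost p N l U.card (numBetter U x) (numBetter U y) (e + 1) (d + 1)
          + (β⁻¹ ^ score t 0 + afterRound p β N M l (score t 0))) := by
  have hβ0 : 0 < β := by linarith
  have hlM : l ≤ M := hM l (by omega)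
  have hK := numBetter_mono U hxy.le
  have hN1 : 1 ≤ N := by have := Nat.AtLeastTwo.prop (n := N); omega
  -- The best arm can only be the better contestant, so its score always drifts upwards.
  have hy0 : (0 : Fin N) ≠ y := fun h => by
    rw [← h] at hxy
    exact absurd hxy (by simp)
  have hreg : regretOf (z :: π) = 1 + regretOf π := by
    rw [regretOf_cons, strongRegret_of_ne]
    rcases hz with rfl | rfl
    exacts [hc.ne, hc.ne.symm]
  have hreg' : (regretOf (z :: π) : ℝ≥0∞) = 1 + regretOf π := by
    rw [hreg]
    push_cast
    rfl
  have hwin : ∀ b, Duel.Defeats ⟨z.1, z.2, b⟩ x y →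
      costToGo P β n (State.update β ⟨t, l, .explore, π⟩ z b) ≤ 1 + regretOf π + ENNReal.ofReal
        (contestCost p N l U.card (numBetter U x) (numBetter U y) (e + 2) d
          + (β⁻¹ ^ (score t 0 + if 0 = x then 1 else 0)
            + afterRound p β N M l (score t 0 + if 0 = x then 1 else 0))) := by
    intro b hb
    have hs : score (⟨z.1, z.2, b⟩ :: t) 0 = score t 0 + if 0 = x then 1 else 0 := by
      rw [score_cons hc.ne hb, if_neg hy0, sub_zero]
    rw [← hreg', ← hs]
    refine costToGo_update_le hp hp1 hβ ih hc hb hl hT π _ ?_ ?_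
    · rintro d' rfl
      exact ih.contest _ t l (z :: π) x y U (e + 1) d' hxy (hc.cons hb) (Or.inl hb) hl (by omega)
    · rintro rfl
      gcongr
      exact reignCost_le_contestCost_left hp hp1 N l U.card (e + 2) hK
  have hlose : ∀ b, Duel.Defeats ⟨z.1, z.2, b⟩ y x →
      costToGo P β n (State.update β ⟨t, l, .explore, π⟩ z b) ≤ 1 + regretOf π + ENNReal.ofReal
        (contestCost p N l U.card (numBetter U x) (numBetter U y) e (d + 2)
          + (β⁻¹ ^ (score t 0 - if 0 = x then 1 else 0)
            + afterRound p β N M l (score t 0 - if 0 = x then 1 else 0))) := by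
    intro b hb
    have hs : score (⟨z.1, z.2, b⟩ :: t) 0 = score t 0 - if 0 = x then 1 else 0 := by
      rw [score_cons hc.ne.symm hb, if_neg hy0, add_zero]
    rw [← hreg', ← hs]
    refine costToGo_update_le hp hp1 hβ ih hc.swap hb hl hT π _ ?_ ?_
    · rintro e' rfl
      exact ih.contest _ t l (z :: π) x y U e' (d + 1) hxy (hc.swap.cons hb).swap (Or.inr hb) hl
        (by omega)
    · rintro rfl
      gcongr
      exact reignCost_le_contestCost_right hp N l U.card _ _ (d + 2)
  have hq := hP x y hxy
  have hq1 : P.prob x y ≤ 1 := by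
    have := P.nonneg y x
    rw [P.symm x y]
    linarith
  have hdrift : P.prob x y
        * (contestCost p N l U.card (numBetter U x) (numBetter U y) (e + 2) d
          + (β⁻¹ ^ (score t 0 + if 0 = x then 1 else 0)
            + afterRound p β N M l (score t 0 + if 0 = x then 1 else 0)))
      + (1 - P.prob x y)
        * (contestCost p N l U.card (numBetter U x) (numBetter U y) e (d + 2)
          + (β⁻¹ ^ (score t 0 - if 0 = x then 1 else 0)
            + afterRound p β N M l (score t 0 - if 0 = x then 1 else 0))) + 1
      ≤ contestCost p N l U.card (numBetter U x) (numBetter U y) (e + 1) (d + 1)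
          + (β⁻¹ ^ score t 0 + afterRound p β N M l (score t 0)) := by
    have h1 := contestCost_drift hp hp1 hq N l U.card e d hK
    have h2 := afterRound_drift hp hp1 hβ hβp hq (N := N) hlM (score t 0)
    split_ifs
    · linear_combination h1 + h2
    · simp only [add_zero, sub_zero]
      linear_combination h1
  have hpos := fun e d c => add_nonneg (contestCost_nonneg hp hp1 N l U.card e d hK)
    (add_nonneg (zpow_nonneg (inv_nonneg.2 hβ0.le) c)
      (afterRound_nonneg hp hp1 hβ0 hN1 hlM c))
  have hyx : P.prob y x = 1 - P.prob x y := P.symm y x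
  rcases hz with rfl | rfl
  · rw [expect_feedback, hyx]
    exact ofReal_average_le _ (by linarith) hq1 (hpos _ _ _) (hpos _ _ _)
      (hwin true (Or.inl ⟨rfl, rfl, rfl⟩)) (hlose false (Or.inr ⟨rfl, rfl, rfl⟩)) hdrift
  · rw [expect_feedback, hyx, add_comm]
    exact ofReal_average_le _ (by linarith) hq1 (hpos _ _ _) (hpos _ _ _)
      (hwin false (Or.inr ⟨rfl, rfl, rfl⟩)) (hlose true (Or.inl ⟨rfl, rfl, rfl⟩)) hdrift

end Induction

/-! ### Better arms left after a challenger is drawn -/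

section NumBetter

variable {N : ℕ} {U : Finset (Fin N)} {k w : Fin N}

theorem numBetter_erase_of_lt (hk : k ∈ U) (hkw : k < w) :
    numBetter (U.erase k) w = numBetter U w - 1 := by
  rw [numBetter, Finset.filter_erase, Finset.card_erase_of_mem (Finset.mem_filter.2 ⟨hk, hkw⟩)]
  rfl

theorem numBetter_erase_of_le (hkw : w ≤ k) : numBetter (U.erase k) w = numBetter U w := by
  rw [numBetter, Finset.filter_erase, Finset.erase_eq_of_notMem]
  · rfl
  · simp [hkw]

theorem sum_filter_numBetter (g : ℕ → ℝ) :
    ∑ k ∈ U.filter (· < w), g (numBetter U k) = ∑ j ∈ Finset.range (numBetter U w), g j := by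
  rw [numBetter, ← sum_card_filter_lt]
  refine Finset.sum_congr rfl fun k hk => ?_
  rw [numBetter, Finset.filter_filter]
  congr 2
  refine Finset.filter_congr fun j _ => ?_
  have := (Finset.mem_filter.1 hk).2
  exact ⟨fun h => ⟨h.trans this, h⟩, fun h => h.2⟩

end NumBetter

/-! ### The induction step for each kind of state -/

section Steps

variable {N : ℕ} {P : Preference N} {p β : ℝ} {T M : ℕ} (hp : 1 / 2 < p) (hp1 : p < 1)

include hp hp1

theorem challenges_interpolate_le {K K' : ℕ} (hK : K ≤ N - 1) (hK' : K' ≤ N - 1) :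
    challenges p K + upsetRatio p * (challenges p K' - challenges p K)
      ≤ challenges p (N - 1) := by
  have h1 := challenges_mono hp hK
  have h2 := challenges_mono hp hK'
  have h3 := upsetRatio_pos hp hp1
  have h4 := upsetRatio_lt_one hp hp1
  nlinarith

theorem challenges_add_upset_le {K b : ℕ} (hK : K ≤ N - 1) (hb : 1 ≤ b) :
    challenges p K + challenges p (N - 1) * (p / (2 * p - 1)) * upsetRatio p ^ b
      ≤ p / (2 * p - 1) * challenges p (N - 1) := by
  have h1 := challenges_mono hp hK
  have hF := challenges_nonneg hp (N - 1)
  have hρ := upsetRatio_pos hp hp1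
  have hr : 0 < 2 * p - 1 := by linarith
  have hp0 : 0 < p := by linarith
  have h2 : upsetRatio p ^ b ≤ upsetRatio p :=
    pow_le_of_le_one hρ.le (upsetRatio_lt_one hp hp1).le (by omega)
  have hA : 0 ≤ challenges p (N - 1) * (p / (2 * p - 1)) := by positivity
  have h3 := mul_le_mul_of_nonneg_left h2 hA
  have hu := upsetRatio_eq hp
  linear_combination h1 + h3 + challenges p (N - 1) * hu

/-- The potential decreases on average when a random challenger is chosen. -/
theorem sum_challenger_le (U : Finset (Fin N)) (w : Fin N) :
    ∑ k ∈ U, (if k < w then 1 + challenges p (numBetter U k) + upsetRatio p *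
        (challenges p (numBetter U w - 1) - challenges p (numBetter U k))
      else challenges p (numBetter U w)) ≤ U.card * challenges p (numBetter U w) := by
  rw [Finset.sum_ite, Finset.sum_const, nsmul_eq_mul,
    sum_filter_numBetter (fun j => 1 + challenges p j + upsetRatio p *
        (challenges p (numBetter U w - 1) - challenges p j))]
  have h1 := sum_challenges_le hp hp1 (numBetter U w)
  have h2 : (numBetter U w : ℝ) + (U.filter fun k => ¬ k < w).card = U.card := by
    exact_mod_cast U.card_filter_add_card_filter_not (fun k => k < w)
  rw [← h2]
  linarith

variable [N.AtLeastTwo]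

/-- The potential at the start of a round. -/
theorem contestCost_start_le {h : List (Duel N)} {l : ℕ} {z a : Fin N} (hl : WinsRound h l z)
    (hza : z ≠ a) :
    (z < a → contestCost p N (l + 1) ((Finset.univ.erase z).erase a).card
        (numBetter ((Finset.univ.erase z).erase a) z)
        (numBetter ((Finset.univ.erase z).erase a) a) (N * l + 1) 1
        + (β⁻¹ ^ score h 0 + afterRound p β N M (l + 1) (score h 0))
      ≤ afterRound p β N M l (score h 0)) ∧
    (a < z → contestCost p N (l + 1) ((Finset.univ.erase z).erase a).card
        (numBetter ((Finset.univ.erase z).erase a) a)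
        (numBetter ((Finset.univ.erase z).erase a) z) 1 (N * l + 1)
        + (β⁻¹ ^ score h 0 + afterRound p β N M (l + 1) (score h 0))
      ≤ afterRound p β N M l (score h 0)) := by
  set U := (Finset.univ.erase z).erase a with hU
  have haU : a ∉ U := by simp [hU]
  have hN := Nat.AtLeastTwo.prop (n := N)
  have hR : (U.card : ℝ) + 1 = N - 1 := by
    rw [hU, Finset.card_erase_of_mem (by simp [hza.symm]), Finset.card_erase_of_mem (by simp),
      Finset.card_univ, Fintype.card_fin, Nat.cast_sub (by omega), Nat.cast_sub (by omega)]
    push_cast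
    ring
  have hr : 0 < 2 * p - 1 := by linarith
  have hp0 : 0 < p := by linarith
  have hρ := upsetRatio_pos hp hp1
  have hF := challenges_nonneg hp (N - 1)
  have hA : 0 ≤ (N : ℝ) * (l + 1 : ℕ) / (2 * p - 1) := by positivity
  rw [afterRound_eq hp N M l (score h 0)]
  have key : ∀ X : ℝ, X ≤ (1 + p / (2 * p - 1) * challenges p (N - 1))
      * (upsetRatio p ^ l * upsetRatio p ^ score h 0) → ∀ Y : ℝ,
      Y ≤ (U.card + 1) / (2 * p - 1) + N * (l + 1 : ℕ) / (2 * p - 1) * X →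
      Y + (β⁻¹ ^ score h 0 + afterRound p β N M (l + 1) (score h 0)) ≤
      (N - 1) / (2 * p - 1)
      + N * (l + 1 : ℕ) / (2 * p - 1) * (1 + p / (2 * p - 1) * challenges p (N - 1))
        * (upsetRatio p ^ l * upsetRatio p ^ score h 0)
      + β⁻¹ ^ score h 0 + afterRound p β N M (l + 1) (score h 0) := by
    intro X hX Y hY
    rw [hR] at hY
    have := mul_le_mul_of_nonneg_left hX hA
    linear_combination this + hY
  -- The weight `ρ ^ (l + score)` of the best arm is `ρ ^ (N l)` if it won the round, enough against
  -- upsets, and `1` otherwise, enough for a wrong incumbent.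
  by_cases hz : z = 0
  · have hC : upsetRatio p ^ l * upsetRatio p ^ score h 0 = upsetRatio p ^ (N * l) := by
      rw [← hz, hl.1, ← zpow_natCast, ← zpow_natCast, ← zpow_add₀ hρ.ne']
      congr 1
      push_cast
      ring
    have hK : numBetter U z = 0 := by
      rw [hz, numBetter, Finset.card_eq_zero, Finset.filter_eq_empty_iff]
      intro k _
      simp
    refine ⟨fun _ => key _ ?_ _ (contestCost_worse_challenger_le hp hp1 _ _ _ _
      (numBetter_le haU a)), fun h => ?_⟩
    · rw [hC, hK]
      have h0 : challenges p 0 = 0 := by simp [challenges]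
      have h1 : upsetRatio p ^ (N * l + 1) ≤ upsetRatio p ^ (N * l) :=
        pow_le_pow_of_le_one hρ.le (upsetRatio_lt_one hp hp1).le (Nat.le_succ _)
      have hB : 0 ≤ challenges p (N - 1) * (p / (2 * p - 1)) := by positivity
      have h2 := mul_le_mul_of_nonneg_left h1 hB
      have h3 : 0 ≤ upsetRatio p ^ (N * l) := by positivity
      rw [h0]
      linear_combination h2 + h3
    · rw [hz] at h
      exact absurd h (by simp)
  · have hC : upsetRatio p ^ l * upsetRatio p ^ score h 0 = 1 := by
      rw [hl.2 0 (Ne.symm hz), zpow_neg, zpow_natCast]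
      exact mul_inv_cancel₀ (pow_ne_zero _ hρ.ne')
    rw [hC] at key ⊢
    constructor
    · intro _
      refine key _ ?_ _ (contestCost_worse_challenger_le hp hp1 _ _ _ _ (numBetter_le haU a))
      have := challenges_add_upset_le hp hp1 (numBetter_le haU z) (Nat.le_add_left 1 (N * l))
      linarith
    · intro _
      refine key _ ?_ _ (contestCost_better_challenger_le hp hp1 (by rw [mul_add]; omega) _ _)
      have h1 := challenges_interpolate_le hp hp1 (numBetter_le haU a) (numBetter_le haU z)
      have h2 := challenges_add_upset_le (N := N) hp hp1 le_rfl (Nat.le_add_left 1 (N * l))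
      linarith

variable (hβ : 1 < β) (hM : ∀ l, minTime β l ≤ T → l ≤ M)

include hβ hM

theorem costToGo_exploit_le {n : ℕ} (ih : CostBounds P p β T M n) {δ : Duel N}
    {t : List (Duel N)} {l : ℕ} (π : List (Fin N × Fin N)) {z a : Fin N} {k : ℕ}
    (hw : WinsRound (δ :: t) l z) (hδ : δ.Defeats z a) (hza : z ≠ a) (hl : 1 ≤ l) (hk : 1 ≤ k)
    (hkl : k ≤ ⌊β ^ l⌋₊) (hT : minTime β (l + 1) + (n + 1) ≤ T + k) :
    costToGo P β (n + 1) ⟨δ :: t, l, .exploit z k, π⟩ ≤ regretOf π + ENNReal.ofReal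
      ((if z = 0 then 0 else (k : ℝ)) + afterRound p β N M l (score (δ :: t) 0)) := by
  have hβ0 : 0 < β := by linarith
  have hN1 : 1 ≤ N := by have := Nat.AtLeastTwo.prop (n := N); omega
  have hlM : l ≤ M := by
    refine hM l ?_
    rw [minTime_succ β hl] at hT
    omega
  have hA := afterRound_nonneg hp hp1 hβ0 hN1 hlM (score (δ :: t) 0)
  have hreg : (regretOf ((z, z) :: π) : ℝ≥0∞)
      = regretOf π + ENNReal.ofReal (if z = 0 then 0 else 1) := by
    rw [regretOf_cons, strongRegret]
    by_cases hz : z = 0 <;> simp [hz, add_comm]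
  have hcollect : ∀ x : ℝ, 0 ≤ x → (regretOf ((z, z) :: π) : ℝ≥0∞) + ENNReal.ofReal x
      = regretOf π + ENNReal.ofReal ((if z = 0 then 0 else 1) + x) := by
    intro x hx
    rw [hreg, add_assoc, ← ENNReal.ofReal_add (by split_ifs <;> norm_num) hx]
  rw [costToGo]
  simp only [State.nextPair]
  rw [expect_pure]
  refine expect_le _ _ _ fun c _ => ?_
  simp only [State.update]
  split_ifs with hk1 hz hz
  · subst hz
    have hza' : (0 : Fin N) < a := lt_of_le_of_ne (Fin.zero_le _) hza
    obtain rfl : k = 1 := by omega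
    -- The last duel decides ties, so the next round opens with the winner against its last
    -- opponent.
    refine (ih.contest δ t (l + 1) _ 0 a _ (N * l) 0 hza' (hw.contest hza) (Or.inl hδ)
      (by omega) (by omega)).trans ?_
    refine (add_le_add_right (ENNReal.ofReal_le_ofReal
      ((contestCost_start_le hp hp1 hw hza).1 hza')) _).trans_eq ?_
    rw [hcollect _ hA]
    simp
  · obtain rfl : k = 1 := by omega
    rw [Nat.cast_one, show (1 : ℝ) + afterRound p β N M l (score (δ :: t) 0)
      = (if z = 0 then 0 else 1) + afterRound p β N M l (score (δ :: t) 0) by rw [if_neg hz],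
      ← hcollect _ hA]
    rcases lt_or_gt_of_ne hza with hlt | hlt
    · exact (ih.contest δ t (l + 1) _ z a _ (N * l) 0 hlt (hw.contest hza) (Or.inl hδ)
        (by omega) (by omega)).trans (add_le_add_right (ENNReal.ofReal_le_ofReal
        ((contestCost_start_le hp hp1 hw hza).1 hlt)) _)
    · exact (ih.contest δ t (l + 1) _ a z _ 0 (N * l) hlt (hw.contest hza).swap (Or.inr hδ)
        (by omega) (by omega)).trans (add_le_add_right (ENNReal.ofReal_le_ofReal
        ((contestCost_start_le hp hp1 hw hza).2 hlt)) _)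
  · refine (ih.exploit δ t l _ z a (k - 1) hw hδ hza hl (by omega) (by omega)
      (by omega)).trans_eq ?_
    rw [if_pos hz, hcollect _ (by simpa using hA), if_pos hz, zero_add]
  · refine (ih.exploit δ t l _ z a (k - 1) hw hδ hza hl (by omega) (by omega)
      (by omega)).trans_eq ?_
    rw [if_neg hz, hcollect _ (add_nonneg (by positivity) hA), if_neg hz, Nat.cast_sub hk]
    congr 2
    push_cast
    ring

variable (hβp : β * (1 - p) ≤ p) (hP : ∀ i j, i < j → p ≤ P.prob i j)

include hβp hP

theorem costToGo_reign_le {n : ℕ} (ih : CostBounds P p β T M n) {δ : Duel N} {t : List (Duel N)}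
    {l : ℕ} (π : List (Fin N × Fin N)) {w a : Fin N} {U : Finset (Fin N)} {b : ℕ}
    (hr : Reigns (δ :: t) l w U b) (hb : 2 ≤ b) (hU : U.Nonempty) (hδ : δ.Defeats w a)
    (ha : a ∉ U) (hl : 1 ≤ l) (hT : minTime β l + (n + 1) ≤ T) :
    costToGo P β (n + 1) ⟨δ :: t, l, .explore, π⟩ ≤ regretOf π + ENNReal.ofReal
      (reignCost p N l U.card (numBetter U w) b
        + (β⁻¹ ^ score (δ :: t) 0 + afterRound p β N M l (score (δ :: t) 0))) := by
  set V := β⁻¹ ^ score (δ :: t) 0 + afterRound p β N M l (score (δ :: t) 0) with hV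
  have hβ0 : 0 < β := by linarith
  have hN1 : 1 ≤ N := by have := Nat.AtLeastTwo.prop (n := N); omega
  have hV0 : 0 ≤ V := add_nonneg (zpow_nonneg (inv_nonneg.2 hβ0.le) _)
    (afterRound_nonneg hp hp1 hβ0 hN1 (hM l (by omega)) _)
  have hr0 : 0 < 2 * p - 1 := by linarith
  have hp0 : 0 < p := by linarith
  have hρ := upsetRatio_pos hp hp1
  have hF := challenges_nonneg hp (N - 1)
  have hcard := Finset.card_pos.2 hU
  obtain ⟨b, rfl⟩ : ∃ b', b = b' + 1 := ⟨b - 1, by omega⟩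
  -- A better challenger costs one challenge; if it then loses it has still left the pool, whence
  -- the `- 1`.
  let G : Fin N → ℝ := fun k => if k < w then 1 + challenges p (numBetter U k) + upsetRatio p *
        (challenges p (numBetter U w - 1) - challenges p (numBetter U k))
      else challenges p (numBetter U w)
  let v : Fin N → ℝ := fun k => U.card / (2 * p - 1) + N * l / (2 * p - 1) *
    (G k + challenges p (N - 1) * (p / (2 * p - 1)) * upsetRatio p ^ (b + 1)) + V
  have hG0 : ∀ k, 0 ≤ G k := by
    intro k
    have h1 := challenges_nonneg hp (numBetter U k)
    have h2 := challenges_nonneg hp (numBetter U w)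
    have h3 := challenges_nonneg hp (numBetter U w - 1)
    have h4 := upsetRatio_lt_one hp hp1
    simp only [G]
    split_ifs
    · nlinarith
    · exact h2
  have hv0 : ∀ k, 0 ≤ v k := by
    intro k
    have := hG0 k
    simp only [v]
    positivity
  have hstep : ∀ k ∈ U, expect (P.feedback w k)
      (fun c => costToGo P β n (State.update β ⟨δ :: t, l, .explore, π⟩ (w, k) c))
      ≤ regretOf π + ENNReal.ofReal (v k) := by
    intro k hk
    have hcon := hr.contest hk
    have hR : ((U.erase k).card : ℝ) + 1 = U.card := by
      exact_mod_cast Finset.card_erase_add_one hk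
    have hkU : k ∉ U.erase k := Finset.notMem_erase k U
    rcases lt_or_gt_of_ne hcon.ne with hwk | hkw
    · refine (expect_feedback_le hp hp1 hβ hβp hP hM ih hwk hcon (Or.inl rfl) hl hT π).trans ?_
      gcongr
      have := contestCost_worse_challenger_le hp hp1 l (U.erase k).card (b + 1)
        (numBetter (U.erase k) w) (numBetter_le hkU k)
      rw [hR, numBetter_erase_of_le hwk.le] at this
      simp only [v, G, if_neg (not_lt.2 hwk.le), numBetter_erase_of_le hwk.le]
      linarith
    · refine (expect_feedback_le hp hp1 hβ hβp hP hM ih hkw hcon.swap (Or.inr rfl) hl hT π).trans ?_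
      gcongr
      have hbN : b + 1 ≤ N * l + 1 := by
        have := hr.total
        omega
      have := contestCost_better_challenger_le hp hp1 (R := (U.erase k).card) hbN
        (numBetter (U.erase k) k) (numBetter (U.erase k) w)
      rw [hR, numBetter_erase_of_le le_rfl, numBetter_erase_of_lt hk hkw] at this
      simp only [v, G, if_pos hkw, numBetter_erase_of_le le_rfl, numBetter_erase_of_lt hk hkw]
      linarith
  have hsum : (U.card : ℝ)⁻¹ * ∑ k ∈ U, v k ≤ reignCost p N l U.card (numBetter U w) (b + 1) + V := by
    have h1 : (0 : ℝ) < U.card := by exact_mod_cast hcard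
    have h2 : ∑ k ∈ U, G k ≤ U.card * challenges p (numBetter U w) := sum_challenger_le hp hp1 U w
    have hA : 0 ≤ (N : ℝ) * l / (2 * p - 1) := by positivity
    have h3 := mul_le_mul_of_nonneg_left h2 hA
    rw [inv_mul_le_iff₀ h1]
    simp only [v, Finset.sum_add_distrib, ← Finset.mul_sum, Finset.sum_const, nsmul_eq_mul,
      reignCost]
    linear_combination h3
  have hc0 : (U.card : ℝ≥0∞) ≠ 0 := by exact_mod_cast hcard.ne'
  calc costToGo P β (n + 1) ⟨δ :: t, l, .explore, π⟩
      ≤ (U.card : ℝ≥0∞)⁻¹ * ∑ k ∈ U, expect (P.feedback w k)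
          (fun c => costToGo P β n (State.update β ⟨δ :: t, l, .explore, π⟩ (w, k) c)) :=
        hr.expect_wswPair_le hb hU hδ ha _
    _ ≤ (U.card : ℝ≥0∞)⁻¹ * ∑ k ∈ U, (regretOf π + ENNReal.ofReal (v k)) := by
        gcongr with k hk
        exact hstep k hk
    _ = regretOf π + (U.card : ℝ≥0∞)⁻¹ * ENNReal.ofReal (∑ k ∈ U, v k) := by
        rw [Finset.sum_add_distrib, Finset.sum_const, nsmul_eq_mul, mul_add, ← mul_assoc,
          ENNReal.inv_mul_cancel hc0 (ENNReal.natCast_ne_top _), one_mul,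
          ENNReal.ofReal_sum_of_nonneg fun k _ => hv0 k]
    _ = regretOf π + ENNReal.ofReal ((U.card : ℝ)⁻¹ * ∑ k ∈ U, v k) := by
        rw [ENNReal.ofReal_mul (by positivity), ENNReal.ofReal_inv_of_pos (by exact_mod_cast hcard),
          ENNReal.ofReal_natCast]
    _ ≤ _ := by gcongr

theorem costBounds (n : ℕ) : CostBounds P p β T M n := by
  induction n with
  | zero =>
    exact ⟨fun _ _ _ _ _ _ _ _ _ _ _ _ _ _ => le_self_add,
      fun _ _ _ _ _ _ _ _ _ _ _ _ _ _ _ => le_self_add,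
      fun _ _ _ _ _ _ _ _ _ _ _ _ _ _ => le_self_add⟩
  | succ n ih =>
    refine ⟨?_, ?_, ?_⟩
    · intro δ t l π x y U e d hxy hc hδ hl hT
      rw [costToGo]
      exact expect_le _ _ _ fun z hz => expect_feedback_le hp hp1 hβ hβp hP hM ih hxy hc
        (hc.wswPair_support hδ hz) hl hT π
    · intro δ t l π w a U b hr hb hU hδ ha hl hT
      exact costToGo_reign_le hp hp1 hβ hM hβp hP ih π hr hb hU hδ ha hl hT
    · intro δ t l π z a k hw hδ hza hl hk hkl hT
      exact costToGo_exploit_le hp hp1 hβ hM ih π hw hδ hza hl hk hkl hT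

theorem costToGo_init_le : costToGo P β T (State.init N) ≤ ENNReal.ofReal
    ((N - 1) / (2 * p - 1) + N / (2 * p - 1) * (p / (2 * p - 1) * challenges p (N - 1))
      + (1 + afterRound p β N M 1 0)) := by
  rcases T with _ | n
  · simp [costToGo, State.init, State.cumRegret]
  have hr : 0 < 2 * p - 1 := by linarith
  have hs : ∀ k : Fin N, score [] k = 0 := fun k => by simp [score, wins]
  have ih := costBounds hp hp1 hβ hM hβp hP n
  have hbound : ∀ (x y : Fin N), x ≠ y → ∀ z, (z = (x, y) ∨ z = (y, x)) →
      expect (P.feedback z.1 z.2)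
        (fun b => costToGo P β n (State.update β (State.init N) z b)) ≤ ENNReal.ofReal
    ((N - 1) / (2 * p - 1) + N / (2 * p - 1) * (p / (2 * p - 1) * challenges p (N - 1))
      + (1 + afterRound p β N M 1 0)) := by
    intro x y hne z hz
    wlog hxy : x < y generalizing x y
    · exact this y x hne.symm hz.symm (lt_of_le_of_ne (not_lt.1 hxy) hne.symm)
    refine (expect_feedback_le hp hp1 hβ hβp hP hM ih hxy (contest_nil hne) hz le_rfl
      (by simp [minTime]) []).trans ?_
    rw [hs, zpow_zero]
    simp only [regretOf, List.map_nil, List.sum_nil, Nat.cast_zero, zero_add]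
    gcongr
    have hN := Nat.AtLeastTwo.prop (n := N)
    set U := (Finset.univ.erase x).erase y with hU
    have hyU : y ∉ U := by simp [hU]
    have hR : (U.card : ℝ) + 1 = N - 1 := by
      rw [hU, Finset.card_erase_of_mem (by simp [hne.symm]), Finset.card_erase_of_mem (by simp),
        Finset.card_univ, Fintype.card_fin, Nat.cast_sub (by omega), Nat.cast_sub (by omega)]
      push_cast
      ring
    refine (contestCost_worse_challenger_le hp hp1 1 U.card 1 _ (numBetter_le hyU y)).trans ?_
    rw [hR, Nat.cast_one, mul_one]
    gcongr
    exact challenges_add_upset_le hp hp1 (numBetter_le hyU x) le_rfl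
  rw [costToGo]
  refine expect_le _ _ _ fun z hz => ?_
  have hne : z.1 ≠ z.2 := by
    simp only [State.nextPair, State.init, wswPair, PMF.mem_support_bind_iff,
      PMF.mem_support_map_iff] at hz
    obtain ⟨i, _, j, hj, rfl⟩ := hz
    have hjA := mem_of_mem_support_breakTie hj
    exact (Finset.ne_of_mem_erase (mem_argmax.1 hjA).1).symm
  exact hbound z.1 z.2 hne z (Or.inl rfl)

end Steps

/-! ### The number of rounds and the final bounds -/

theorem exists_last_round (β : ℝ) (T : ℕ) :
    ∃ M, 1 ≤ M ∧ minTime β M ≤ T ∧ ∀ l, minTime β l ≤ T → l ≤ M := by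
  have hle : ∀ l, minTime β l ≤ T → l ≤ T + 1 := by
    intro l hl
    have h1 : ∑ i ∈ Finset.Ico 1 l, 1 ≤ minTime β l := Finset.sum_le_sum fun i _ => by omega
    simp only [Finset.sum_const, Nat.card_Ico, smul_eq_mul, mul_one] at h1
    omega
  have h1 : minTime β 1 ≤ T := by simp [minTime]
  exact ⟨Nat.findGreatest (fun l => minTime β l ≤ T) (T + 1),
    Nat.le_findGreatest (hle 1 h1) h1,
    Nat.findGreatest_spec (P := fun l => minTime β l ≤ T) (hle 1 h1) h1,
    fun l hl => Nat.le_findGreatest (hle l hl) hl⟩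

/-- Each summand of `minTime` is at least `β ^ i`; the geometric series gives the rest. -/
theorem pow_le_of_minTime_le {β : ℝ} (hβ : 1 < β) {M T : ℕ} (hM : 1 ≤ M) (hT : minTime β M ≤ T) :
    β ^ M ≤ T * (β - 1) + β := by
  have key : ∀ k, β ^ (k + 1) ≤ minTime β (k + 1) * (β - 1) + β := by
    intro k
    induction k with
    | zero => simp [minTime]
    | succ k ih =>
      rw [minTime_succ β (Nat.le_add_left 1 k)]
      have h := (Nat.lt_floor_add_one (β ^ (k + 1))).le
      have h2 := mul_le_mul_of_nonneg_right h (sub_nonneg.2 hβ.le)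
      push_cast
      rw [pow_succ β (k + 1)]
      linarith
  obtain ⟨k, rfl⟩ : ∃ k, M = k + 1 := ⟨M - 1, by omega⟩
  refine (key k).trans ?_
  have : (minTime β (k + 1) : ℝ) ≤ T := by exact_mod_cast hT
  have h2 := mul_le_mul_of_nonneg_right this (sub_nonneg.2 hβ.le)
  linarith

theorem wssExpectedRegret_le_of_lt_one {N : ℕ} [N.AtLeastTwo] (P : Preference N) {p β : ℝ}
    {T M : ℕ} (hp : 1 / 2 < p) (hp1 : p < 1) (hβ : 1 < β) (hβp : β * (1 - p) ≤ p)
    (hP : ∀ i j, i < j → p ≤ P.prob i j)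
    (hM : ∀ l, minTime β l ≤ T → l ≤ M) :
    wssExpectedRegret P β T ≤ ENNReal.ofReal (N / (2 * p - 1) * ((p / (2 * p - 1)) ^ 4
      * (harmonic (N - 1) : ℝ) + (p / (2 * p - 1)) ^ 2 - 1 + M)) := by
  rw [wssExpectedRegret_eq_costToGo]
  refine (costToGo_init_le hp hp1 hβ hM hβp hP).trans (ENNReal.ofReal_le_ofReal ?_)
  have hr : 0 < 2 * p - 1 := by linarith
  have hu := upsetRatio_eq hp
  have hone : 1 ≤ 1 / (2 * p - 1) := by
    rw [le_div_iff₀ hr]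
    linarith
  have hM' : (0 : ℝ) ≤ M := by positivity
  have hm := mul_le_mul_of_nonneg_left hone hM'
  simp only [afterRound, challenges, zpow_zero, pow_one]
  set u := p / (2 * p - 1)
  set ρ := upsetRatio p
  push_cast
  have hmul : ρ * (1 * u + u ^ 2) = u ^ 2 - 1 := by linear_combination (1 + u) * hu
  rw [hmul]
  linear_combination hm

/-- At `p = 1` the ratio `ρ` vanishes and its negative powers are of no use. All hypotheses persist
for `q < p` close to `p`, and the bound is continuous, so it passes to the left limit. -/
theorem wssExpectedRegret_le {N : ℕ} [N.AtLeastTwo] (P : Preference N) {p β : ℝ}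
    {T M : ℕ} (hp : 1 / 2 < p) (hp1 : p ≤ 1) (hβ : 1 < β) (hβp : β * (1 - p) < p)
    (hP : ∀ i j, i < j → p ≤ P.prob i j)
    (hM : ∀ l, minTime β l ≤ T → l ≤ M) :
    wssExpectedRegret P β T ≤ ENNReal.ofReal (N / (2 * p - 1) * ((p / (2 * p - 1)) ^ 4
      * (harmonic (N - 1) : ℝ) + (p / (2 * p - 1)) ^ 2 - 1 + M)) := by
  have hr : 2 * p - 1 ≠ 0 := by linarith
  have hc : ContinuousAt (fun q : ℝ => ENNReal.ofReal (N / (2 * q - 1) * ((q / (2 * q - 1)) ^ 4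
      * (harmonic (N - 1) : ℝ) + (q / (2 * q - 1)) ^ 2 - 1 + M))) p := by
    refine ENNReal.continuous_ofReal.continuousAt.comp ?_
    fun_prop (disch := assumption)
  refine ge_of_tendsto (hc.tendsto.mono_left (nhdsWithin_le_nhds (s := Set.Iio p))) ?_
  have h1 : ∀ᶠ q in nhds p, 1 / 2 < q := lt_mem_nhds hp
  have h2 : ∀ᶠ q in nhds p, β * (1 - q) < q :=
    ContinuousAt.eventually_lt (by fun_prop) (by fun_prop) hβp
  filter_upwards [self_mem_nhdsWithin, nhdsWithin_le_nhds h1, nhdsWithin_le_nhds h2]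
    with q hq hq1 hq2
  have hqp : q < p := hq
  exact wssExpectedRegret_le_of_lt_one P hq1 (by linarith) hβ hq2.le
    (fun i j hij => hqp.le.trans (hP i j hij)) hM

/-- Dropping `1 / N` from `H_N ≤ 1 + log N` leaves a surplus `1 - 1 / N ≤ log N`. -/
theorem harmonic_pred_le {N : ℕ} (hN : 1 ≤ N) :
    (harmonic (N - 1) : ℝ) + 2 ≤ 2 * (Real.log N + 1) := by
  obtain ⟨n, rfl⟩ : ∃ n, N = n + 1 := ⟨N - 1, by omega⟩
  have h1 := harmonic_le_one_add_log (n + 1)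
  have h2 := Real.one_sub_inv_le_log_of_pos (x := ((n + 1 : ℕ) : ℝ)) (by positivity)
  rw [harmonic_succ] at h1
  push_cast at h1 h2 ⊢
  linarith

/-- With `v = 1 / (2p - 1)` the right side is `2 u³ v² L ≥ u³ v² (H + 2)`, which dominates termwise
since `1 ≤ u ≤ v`. Having `+ 1` in place of `- 1` on the left saves two rounds, hence `M - 2` later.
-/
theorem leading_term_le {p H L : ℝ} (hp : 1 / 2 < p) (hp1 : p ≤ 1) (hH : 0 ≤ H)
    (hL : H + 2 ≤ 2 * L) :
    (p / (2 * p - 1)) ^ 4 * H + (p / (2 * p - 1)) ^ 2 + 1 ≤ 2 * p ^ 3 / (2 * p - 1) ^ 5 * L := by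
  have hr : 0 < 2 * p - 1 := by linarith
  have hp0 : 0 < p := by linarith
  have hu : 1 ≤ p / (2 * p - 1) := by rw [le_div_iff₀ hr]; linarith
  have hv : 1 ≤ 1 / (2 * p - 1) := by rw [le_div_iff₀ hr]; linarith
  have e : p ^ 3 / (2 * p - 1) ^ 5 = (p / (2 * p - 1)) ^ 3 * (1 / (2 * p - 1)) ^ 2 := by
    field_simp
  have hpv : p / (2 * p - 1) ≤ 1 / (2 * p - 1) := by gcongr
  rw [mul_div_assoc, e]
  set u := p / (2 * p - 1)
  set v := 1 / (2 * p - 1)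
  have hv2 : v ≤ v ^ 2 := le_self_pow₀ hv (by norm_num)
  have h4 : u ^ 4 ≤ u ^ 3 * v ^ 2 := by
    rw [pow_succ]
    gcongr
    linarith
  have h2 : u ^ 2 ≤ u ^ 3 * v ^ 2 :=
    (pow_le_pow_right₀ hu (by norm_num)).trans
      (le_mul_of_one_le_right (by positivity) (one_le_pow₀ hv))
  have h0 : 1 ≤ u ^ 3 * v ^ 2 := one_le_mul_of_one_le_of_one_le (one_le_pow₀ hu) (one_le_pow₀ hv)
  have h5 := mul_le_mul_of_nonneg_right h4 hH
  have h6 := mul_le_mul_of_nonneg_left hL (by positivity : 0 ≤ u ^ 3 * v ^ 2)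
  linarith

/-- The bound in terms of the number of rounds. -/
theorem exists_round_wssExpectedRegret_le {N : ℕ} [N.AtLeastTwo] (P : Preference N) {p β : ℝ}
    (hp : 1 / 2 < p) (hp1 : p ≤ 1) (hβ : 1 < β) (hβp : β * (1 - p) < p)
    (hP : ∀ i j, i < j → p ≤ P.prob i j) (T : ℕ) :
    ∃ M : ℕ, β ^ M ≤ T * (β - 1) + β ∧ wssExpectedRegret P β T ≤ ENNReal.ofReal
      (2 * p ^ 3 / (2 * p - 1) ^ 6 * ((N : ℝ) * (Real.log (N : ℝ) + 1))
        + N * (M - 2) / (2 * p - 1)) := by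
  obtain ⟨M, hM1, hMT, hM⟩ := exists_last_round β T
  refine ⟨M, pow_le_of_minTime_le hβ hM1 hMT,
    (wssExpectedRegret_le P hp hp1 hβ hβp hP hM).trans (ENNReal.ofReal_le_ofReal ?_)⟩
  have hr : 0 < 2 * p - 1 := by linarith
  have hH : (0 : ℝ) ≤ harmonic (N - 1) := by
    have := harmonic_mono (Nat.zero_le (N - 1))
    simpa using this
  have hN := Nat.AtLeastTwo.prop (n := N)
  have h := leading_term_le hp hp1 hH (harmonic_pred_le (by omega : 1 ≤ N))
  have hN' : (0 : ℝ) ≤ N / (2 * p - 1) := by positivity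
  have h2 := mul_le_mul_of_nonneg_left h hN'
  have e : 2 * p ^ 3 / (2 * p - 1) ^ 6 * ((N : ℝ) * (Real.log (N : ℝ) + 1))
      = N / (2 * p - 1) * (2 * p ^ 3 / (2 * p - 1) ^ 5 * (Real.log N + 1)) := by
    field_simp
  rw [e]
  linear_combination h2

theorem wssExpectedRegret_le_logb {N : ℕ} [N.AtLeastTwo] (P : Preference N) {p β : ℝ}
    (hp : 1 / 2 < p) (hp1 : p ≤ 1) (hβ : 1 < β) (hβp : β * (1 - p) < p)
    (hP : ∀ i j, i < j → p ≤ P.prob i j) (T : ℕ) :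
    wssExpectedRegret P β T ≤ ENNReal.ofReal
          (2 * p ^ 3 / (2 * p - 1) ^ 6 * ((N : ℝ) * (Real.log (N : ℝ) + 1))
            + (N : ℝ) * Real.logb β ((T : ℝ) * (β - 1) + 1) / (2 * p - 1)) ∧
        (1 / (β - 1) ^ 2 ≤ (T : ℝ) →
          wssExpectedRegret P β T ≤ ENNReal.ofReal
            (2 * p ^ 3 / (2 * p - 1) ^ 6 * ((N : ℝ) * (Real.log (N : ℝ) + 1))
              + (N : ℝ) * Real.logb β ((T : ℝ) * (β - 1)) / (2 * p - 1))) := by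
  obtain ⟨M, hM, hE⟩ := exists_round_wssExpectedRegret_le P hp hp1 hβ hβp hP T
  have hr : 0 < 2 * p - 1 := by linarith
  have hβ0 : 0 < β := by linarith
  have hβ1 : 0 < β - 1 := by linarith
  have key : ∀ x : ℝ, 0 < x → T * (β - 1) + β ≤ β ^ 2 * x → (M : ℝ) - 2 ≤ Real.logb β x := by
    intro x hx h
    rw [Real.le_logb_iff_rpow_le hβ hx, Real.rpow_sub hβ0, Real.rpow_natCast,
      Real.rpow_ofNat, div_le_iff₀ (by positivity)]
    linarith
  constructor
  · refine hE.trans (ENNReal.ofReal_le_ofReal ?_)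
    gcongr
    refine key _ (by positivity) ?_
    have h1 : (0 : ℝ) ≤ T * (β - 1) := by positivity
    have h2 := le_mul_of_one_le_left h1 (one_le_pow₀ hβ.le (n := 2))
    have h3 : β ≤ β ^ 2 := le_self_pow₀ hβ.le (by norm_num)
    linarith
  · intro hT
    have hT0 : (0 : ℝ) < T := lt_of_lt_of_le (by positivity) hT
    refine hE.trans (ENNReal.ofReal_le_ofReal ?_)
    gcongr
    refine key _ (by positivity) ?_
    rw [div_le_iff₀ (by positivity)] at hT
    have h1 : (0 : ℝ) ≤ T * (β - 1) := by positivity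
    -- The claim amounts to `β ≤ (β + 1) T (β - 1)²`.
    nlinarith [mul_le_mul_of_nonneg_left hT hβ0.le]

/-- Additive constants are absorbed by `1 ≤ log N / log 2`, and `T (β - 1) + 1 ≤ T β` because `T ≥
1`. -/
theorem logb_bound_le {p β A : ℝ} {N T : ℕ} (hp : 1 / 2 < p) (hβ : 1 < β) (hA : 0 ≤ A)
    (hN : 2 ≤ N) (hT : 1 ≤ T) :
    A * ((N : ℝ) * (Real.log (N : ℝ) + 1))
        + (N : ℝ) * Real.logb β ((T : ℝ) * (β - 1) + 1) / (2 * p - 1)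
      ≤ (A * (1 + 1 / Real.log 2) + (1 / Real.log 2 + 1 / Real.log β) / (2 * p - 1))
        * ((N : ℝ) * Real.log (N : ℝ) + (N : ℝ) * Real.log (T : ℝ)) := by
  have hr : 0 < 2 * p - 1 := by linarith
  have hT' : (1 : ℝ) ≤ T := by exact_mod_cast hT
  have hN' : (2 : ℝ) ≤ N := by exact_mod_cast hN
  have hl2 : 0 < Real.log 2 := Real.log_pos (by norm_num)
  have hlβ : 0 < Real.log β := Real.log_pos hβ
  have hlT : 0 ≤ Real.log T := Real.log_nonneg hT'
  have hlN : Real.log 2 ≤ Real.log N := Real.log_le_log (by norm_num) hN'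
  have h1 : 1 ≤ 1 / Real.log 2 * Real.log N := by
    rw [one_div, inv_mul_eq_div, le_div_iff₀ hl2]
    linarith
  have h2 : Real.logb β ((T : ℝ) * (β - 1) + 1) ≤ 1 + 1 / Real.log β * Real.log T := by
    have h3 : Real.logb β ((T : ℝ) * (β - 1) + 1) ≤ Real.logb β (T * β) :=
      Real.logb_le_logb_of_le hβ (by nlinarith) (by linarith)
    rw [Real.logb_mul (by linarith) (by linarith), Real.logb_self_eq_one hβ] at h3
    rw [one_div, inv_mul_eq_div]
    exact h3.trans_eq (add_comm _ _)
  have hlN0 : 0 ≤ Real.log N := hl2.le.trans hlN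
  have h4 : Real.log N + 1 ≤ (1 + 1 / Real.log 2) * (Real.log N + Real.log T) := by
    have : 0 ≤ (1 + 1 / Real.log 2) * Real.log T := by positivity
    linarith
  have h5 : Real.logb β ((T : ℝ) * (β - 1) + 1)
      ≤ (1 / Real.log 2 + 1 / Real.log β) * (Real.log N + Real.log T) := by
    have h6 : 0 ≤ 1 / Real.log 2 * Real.log T := by positivity
    have h7 : 0 ≤ 1 / Real.log β * Real.log N := by positivity
    linarith
  calc A * ((N : ℝ) * (Real.log (N : ℝ) + 1))
        + (N : ℝ) * Real.logb β ((T : ℝ) * (β - 1) + 1) / (2 * p - 1)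
      ≤ A * ((N : ℝ) * ((1 + 1 / Real.log 2) * (Real.log N + Real.log T)))
        + (N : ℝ) * ((1 / Real.log 2 + 1 / Real.log β) * (Real.log N + Real.log T))
          / (2 * p - 1) := by gcongr
    _ = _ := by ring

end DuelingBandit

end

/-- Bounds on the expected cumulative strong regret of WS-S under a total order. The condition
`β * (1 - p) < p` is `β < p / (1 - p)`, read as no upper bound on `β` if `p = 1`. -/
theorem theorem3 (p β : ℝ) (hβ : 1 < β) (hβp : β * (1 - p) < p) :
    (∀ (N : ℕ) [N.AtLeastTwo] (P : DuelingBandit.Preference N),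
      P.TotallyOrdered → IsLeast P.favourProbs p → ∀ T : ℕ,
        DuelingBandit.wssExpectedRegret P β T ≤ ENNReal.ofReal
          (2 * p ^ 3 / (2 * p - 1) ^ 6 * ((N : ℝ) * (Real.log (N : ℝ) + 1))
            + (N : ℝ) * Real.logb β ((T : ℝ) * (β - 1) + 1) / (2 * p - 1)) ∧
        (1 / (β - 1) ^ 2 ≤ (T : ℝ) →
          DuelingBandit.wssExpectedRegret P β T ≤ ENNReal.ofReal
            (2 * p ^ 3 / (2 * p - 1) ^ 6 * ((N : ℝ) * (Real.log (N : ℝ) + 1))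
              + (N : ℝ) * Real.logb β ((T : ℝ) * (β - 1)) / (2 * p - 1)))) ∧
    ∃ C : ℝ, ∀ (N : ℕ) [N.AtLeastTwo] (P : DuelingBandit.Preference N),
      P.TotallyOrdered → IsLeast P.favourProbs p → ∀ T : ℕ, 1 ≤ T →
        DuelingBandit.wssExpectedRegret P β T ≤ ENNReal.ofReal
          (C * ((N : ℝ) * Real.log (N : ℝ) + (N : ℝ) * Real.log (T : ℝ))) := by
  have hyp : ∀ (N : ℕ) [N.AtLeastTwo] (P : DuelingBandit.Preference N), P.TotallyOrdered →
      IsLeast P.favourProbs p → 1 / 2 < p ∧ p ≤ 1 ∧ ∀ i j, i < j → p ≤ P.prob i j := by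
    rintro N _ P hord ⟨⟨i, j, hij, hp⟩, hmin⟩
    refine ⟨hp, ?_, fun i j h => hmin ⟨i, j, rfl, hord i j h⟩⟩
    have h1 := P.nonneg j i
    have h2 := P.symm i j
    linarith
  constructor
  · intro N _ P hord hleast T
    obtain ⟨hp, hp1, hP⟩ := hyp N P hord hleast
    exact DuelingBandit.wssExpectedRegret_le_logb P hp hp1 hβ hβp hP T
  -- The constant is fixed before any instance is given; `1 / 2 < p` becomes available only with
  -- one.
  · refine ⟨2 * p ^ 3 / (2 * p - 1) ^ 6 * (1 + 1 / Real.log 2)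
      + (1 / Real.log 2 + 1 / Real.log β) / (2 * p - 1), fun N _ P hord hleast T hT => ?_⟩
    obtain ⟨hp, hp1, hP⟩ := hyp N P hord hleast
    have hp0 : 0 < p := by linarith
    exact ((DuelingBandit.wssExpectedRegret_le_logb P hp hp1 hβ hβp hP T).1.trans
      (ENNReal.ofReal_le_ofReal (DuelingBandit.logb_bound_le hp hβ
        (div_nonneg (by positivity) (by positivity)) Nat.AtLeastTwo.prop hT)))
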